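/- Let $n\ge 0$. Let $B_n$ be the group of permutations $w$ of $\{\pm1,\dots,\pm n\}$ with $w(-i)=-w(i)$ for all $i$. For $a_1,\dots,a_k$ in $\{\pm1,\dots,\pm n\}$ with pairwise distinct absolute values put $((a_1,\dots,a_k))=(a_1\cdots a_k)(-a_1\cdots -a_k)$ (a paired cycle) and $[a_1,\dots,a_k]=(a_1\cdots a_k\,{-a_1}\cdots {-a_k})$ (a balanced cycle); every $w\in B_n$ is a product of disjoint paired and balanced cycles, called the cycles of $w$. The reflections of $B_n$ are the elements $[i]$ $(1\le i\le n)$ and $((i,j)),((i,-j))$ $(1\le i<j\le n)$. Let $D_n$ be the subgroup of $B_n$ generated by the elements $((i,j)),((i,-j))$ $(1\le i<j\le n)$, which are the reflections of $D_n$. For $W=B_n$ or $W=D_n$, the absolute length $\ell_W(w)$ of $w\in W$ is the least $k$ such that $w$ is a product of $k$ reflections of $W$, and $\mathrm{Abs}(W)$ is $W$ with the partial order $u\preceq v \iff \ell_W(u)+\ell_W(u^{-1}v)=\ell_W(v)$. For $w\in B_n$ let $\mu(w)$ be the integer partition whose parts are the absolute lengths $\ell_{B_n}(c)$ of the balanced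 cycles $c$ of $w$. Theorem. Let $w\in D_n$. The interval $[e,w]=\{u\in D_n: e\preceq u\preceq w\}$ of $\mathrm{Abs}(D_n)$, with the induced order, is a lattice if and only if $w$ has no balanced cycles (that is, $\mu(w)=\varnothing$), or $\mu(w)=(k,1)$ for some integer $k$ with $1\le k\le n-1$, or $\mu(w)=(1,1,1,1)$. -/

import Mathlib

/-- The set `{±1, …, ±n}`: the pair `(i, ε)` stands for the signed integer `ε · (i + 1)`. -/
abbrev SignedPoint (n : ℕ) : Type := Fin n × ℤˣ

/-- The map `x ↦ -x` on `{±1, …, ±n}`. -/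
def SignedPoint.opp {n : ℕ} (x : SignedPoint n) : SignedPoint n := (x.1, -x.2)

/-- The hyperoctahedral group `B_n`: all permutations `w` of `{±1, …, ±n}`
with `w (-x) = -w x`. -/
def GroupB (n : ℕ) : Subgroup (Equiv.Perm (SignedPoint n)) where
  carrier := {w | ∀ x, w x.opp = (w x).opp}
  one_mem' := fun _ => rfl
  mul_mem' := by
    intro u v hu hv x
    simp only [Equiv.Perm.mul_apply]
    rw [hv x, hu (v x)]
  inv_mem' := by
    intro u hu x
    rw [Equiv.Perm.inv_eq_iff_eq, hu]
    exact congrArg SignedPoint.opp (u.apply_symm_apply x).symm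

/-- The product `((a₁, …, a_k)) = (a₁ ⋯ a_k)(-a₁ ⋯ -a_k)`; a paired `k`-cycle when the
`a_i` have distinct absolute values. -/
def pairedPerm {n : ℕ} (l : List (SignedPoint n)) : Equiv.Perm (SignedPoint n) :=
  l.formPerm * (l.map SignedPoint.opp).formPerm

/-- The cycle `[a₁, …, a_k] = (a₁ ⋯ a_k -a₁ ⋯ -a_k)`; a balanced `k`-cycle when the
`a_i` have distinct absolute values. -/
def balancedPerm {n : ℕ} (l : List (SignedPoint n)) : Equiv.Perm (SignedPoint n) :=
  (l ++ l.map SignedPoint.opp).formPerm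

/-- `c` is a balanced cycle `[a₁, …, a_k]`, `k ≥ 1`, with `|a₁|, …, |a_k|` distinct. -/
def IsBalancedCycle {n : ℕ} (c : Equiv.Perm (SignedPoint n)) : Prop :=
  ∃ l : List (SignedPoint n), l ≠ [] ∧ (l.map Prod.fst).Nodup ∧ c = balancedPerm l

/-- The elements `((i, j))` and `((i, -j))` of `B_n`, for `i < j`. -/
def pairedReflections (n : ℕ) : Set (GroupB n) :=
  {t | ∃ i j : Fin n, i < j ∧
    ((t : Equiv.Perm (SignedPoint n)) = pairedPerm [(i, 1), (j, 1)] ∨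
     (t : Equiv.Perm (SignedPoint n)) = pairedPerm [(i, 1), (j, -1)])}

/-- The reflections of `B_n`: all `[i]`, and all `((i, j))`, `((i, -j))` for `i < j`. -/
def reflectionsB (n : ℕ) : Set (GroupB n) :=
  {t | ∃ i : Fin n, (t : Equiv.Perm (SignedPoint n)) = balancedPerm [(i, 1)]} ∪
    pairedReflections n

/-- The group `D_n`: the subgroup of `B_n` generated by all `((i, j))`, `((i, -j))`, `i < j`. -/
def GroupD (n : ℕ) : Subgroup (GroupB n) := Subgroup.closure (pairedReflections n)

/-- The reflections of `D_n`: all `((i, j))`, `((i, -j))` for `i < j`. -/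
def reflectionsD (n : ℕ) : Set (GroupD n) := {t | (t : GroupB n) ∈ pairedReflections n}

/-- The absolute length of `w` with respect to the set `T`: the smallest `k` such that `w` is a
product of `k` elements of `T`. It is used only for sets `T` such that every element of `W` is
such a product. -/
noncomputable def absLength {W : Type*} [Group W] (T : Set W) (w : W) : ℕ :=
  sInf {k | ∃ l : List W, l.length = k ∧ (∀ t ∈ l, t ∈ T) ∧ l.prod = w}

/-- The absolute order: `u ⪯ v` iff `ℓ(u) + ℓ(u⁻¹ v) = ℓ(v)`. -/
def AbsLE {W : Type*} [Group W] (T : Set W) (u v : W) : Prop :=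
  absLength T u + absLength T (u⁻¹ * v) = absLength T v

/-- The closed interval `[u, v]` in the absolute order. -/
def absInterval {W : Type*} [Group W] (T : Set W) (u v : W) : Set W :=
  {x | AbsLE T u x ∧ AbsLE T x v}

/-- The closed interval `[u, v]`, with the order induced from the absolute order, is a lattice. -/
def AbsIntervalIsLattice {W : Type*} [Group W] (T : Set W) (u v : W) : Prop :=
  ∃ L : Lattice (absInterval T u v), ∀ a b : absInterval T u v, L.le a b ↔ AbsLE T (a : W) (b : W)

open Classical in
/-- The partition `μ(w)` of `w ∈ B_n`, as the multiset of its parts: the absolute lengths in `B_n`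
of the balanced cycles in the cycle decomposition of `w`. -/
noncomputable def balancedPartition {n : ℕ} (w : GroupB n) : Multiset ℕ :=
  (Finset.univ.filter fun c : GroupB n =>
      IsBalancedCycle (c : Equiv.Perm (SignedPoint n)) ∧
      (c : Equiv.Perm (SignedPoint n)) ∈
        (w : Equiv.Perm (SignedPoint n)).cycleFactorsFinset).val.map
    (absLength (reflectionsB n))

/-! Let `B_n` act on `ℝ^n` by signed permutation matrices. In `B_n` and in `D_n` alike the absolute
length of `w` is the rank of `w - 1` (`absLength_reflectionsB`, `absLength_reflectionsD`), so the
order is the one that this rank defines on orthogonal maps. There, elements below a common `w` are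
compared by inclusion of their moved spaces (`below_of_mov_le`), and the form `⟨(w - 1)⁻¹ ξ, η⟩` on
`mov w` restricts to the form of every `u ≤ w` (`Below.inner_preimage_eq`). On signed basis vectors
at balanced points this form is `±1/2` inside a cycle and `0` between different cycles. Hence the
balanced points of `u ≤ w` are grouped into cycles as they are in `w` (`bal_form_eq`). Since `D_n`
consists of the elements with an even number of balanced cycles, everything becomes a question of
parity.

Failure of joins: an odd `β` may be spanned by two even elements `x`, `y` while the moved spaces of
two even upper bounds `p`, `q` meet exactly in that of `β`. A join of `x` and `y` would then have to
be `β` (`not_hasJoin`). Such a configuration exists if a balanced cycle of length at least two is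
accompanied by two further balanced indices, and also if there are five balanced cycles. With
parity, only the listed partitions survive.

Existence of joins: the remaining elements form a class closed downwards in `D_n`
(`IsLatticeType.of_le`), and in such a class joins of pairs of reflections suffice
(`hasJoin_of_atoms`). If the two roots are orthogonal for the form of `w` in one of the two orders,
a product of the reflections is the join. Otherwise the roots cross. If some upper bound has them in
a paired cycle, its restriction to the indices of the roots is the join
(`IsLatticeType.hasJoin_of_paired`); if all upper bounds have them in balanced cycles, parity forces
further balanced points into every upper bound, and a restriction of `w` is the join
(`IsLatticeType.hasJoin_of_balanced`). -/

/-! ### The rank order on linear isometries and the form `⟨(w - 1)⁻¹ ξ, η⟩`. -/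

section Isometries

variable {V : Type*} [NormedAddCommGroup V] [InnerProductSpace ℝ V]

/-- The moved space `range (g - 1)` of a linear isometry. -/
noncomputable def mov (g : V ≃ₗᵢ[ℝ] V) : Submodule ℝ V :=
  LinearMap.range (g.toLinearEquiv.toLinearMap - LinearMap.id)

/-- The fixed space `ker (g - 1)` of a linear isometry. -/
noncomputable def fixSpace (g : V ≃ₗᵢ[ℝ] V) : Submodule ℝ V :=
  LinearMap.ker (g.toLinearEquiv.toLinearMap - LinearMap.id)

theorem mem_mov {g : V ≃ₗᵢ[ℝ] V} {x : V} : x ∈ mov g ↔ ∃ y, g y - y = x := by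
  simp [mov]

theorem sub_mem_mov (g : V ≃ₗᵢ[ℝ] V) (y : V) : g y - y ∈ mov g := mem_mov.2 ⟨y, rfl⟩

theorem mem_fixSpace {g : V ≃ₗᵢ[ℝ] V} {x : V} : x ∈ fixSpace g ↔ g x = x := by
  simp [fixSpace, sub_eq_zero]

theorem inner_mov_fixSpace {g : V ≃ₗᵢ[ℝ] V} {x f : V} (hx : x ∈ mov g) (hf : g f = f) :
    inner ℝ x f = 0 := by
  obtain ⟨y, rfl⟩ := mem_mov.1 hx
  have := g.inner_map_map y f
  rw [hf] at this
  rw [inner_sub_left, this, sub_self]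

/-- Since `g` preserves norms, `‖g f - f‖² = -2 ⟨g f - f, f⟩`. -/
theorem fixed_of_inner_mov {g : V ≃ₗᵢ[ℝ] V} {f : V} (h : inner ℝ (g f - f) f = 0) :
    g f = f := by
  rw [← sub_eq_zero, ← inner_self_eq_zero (𝕜 := ℝ)]
  have h1 := g.inner_map_map f f
  have h2 : inner ℝ f (g f) = inner ℝ (g f) f := real_inner_comm _ _
  simp only [inner_sub_left, inner_sub_right] at *
  linarith

theorem fixed_of_mov_le {u w : V ≃ₗᵢ[ℝ] V} (h : mov u ≤ mov w) {f : V} (hf : w f = f) :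
    u f = f :=
  fixed_of_inner_mov (inner_mov_fixSpace (h (sub_mem_mov u f)) hf)

/-- The rank of `g - 1`. -/
noncomputable def rk (g : V ≃ₗᵢ[ℝ] V) : ℕ := Module.finrank ℝ (mov g)

/-- The order `u ≤ w` on isometries: `rank (u - 1)` and `rank (u⁻¹ w - 1)` add up to
`rank (w - 1)`. -/
def Below (u w : V ≃ₗᵢ[ℝ] V) : Prop := rk u + rk (u⁻¹ * w) = rk w

theorem mov_mul_le (g h : V ≃ₗᵢ[ℝ] V) : mov (g * h) ≤ mov g ⊔ mov h := by
  intro x hx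
  obtain ⟨y, rfl⟩ := mem_mov.1 hx
  have : (g * h) y - y = (g (h y) - h y) + (h y - y) := by simp
  rw [this]
  exact Submodule.add_mem_sup (sub_mem_mov g _) (sub_mem_mov h _)

theorem mov_one : mov (1 : V ≃ₗᵢ[ℝ] V) = ⊥ := by
  rw [eq_bot_iff]
  intro x hx
  obtain ⟨y, rfl⟩ := mem_mov.1 hx
  simp

theorem mov_eq_bot {g : V ≃ₗᵢ[ℝ] V} (h : mov g = ⊥) : g = 1 := by
  ext y
  have := sub_mem_mov g y
  rw [h, Submodule.mem_bot, sub_eq_zero] at this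
  simpa using this

theorem rk_one : rk (1 : V ≃ₗᵢ[ℝ] V) = 0 := by rw [rk, mov_one, finrank_bot]

theorem mov_conj (g h : V ≃ₗᵢ[ℝ] V) : mov (h * g * h⁻¹) = (mov g).map h.toLinearEquiv.toLinearMap := by
  ext x
  simp only [Submodule.mem_map, mem_mov]
  constructor
  · rintro ⟨y, rfl⟩
    refine ⟨_, ⟨h⁻¹ y, rfl⟩, ?_⟩
    simp
  · rintro ⟨_, ⟨y, rfl⟩, rfl⟩
    refine ⟨h y, ?_⟩
    simp

theorem rk_conj (g h : V ≃ₗᵢ[ℝ] V) : rk (h * g * h⁻¹) = rk g := by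
  rw [rk, mov_conj]
  exact LinearEquiv.finrank_map_eq h.toLinearEquiv (mov g)

theorem rk_mul_comm (g h : V ≃ₗᵢ[ℝ] V) : rk (g * h) = rk (h * g) := by
  have := rk_conj (g * h) h
  rw [← this]; congr 1; group

/-- Polarisation of the invariance of the inner product. -/
theorem inner_preimage_add {w : V ≃ₗᵢ[ℝ] V} {y₁ y₂ ξ η : V} (h₁ : w y₁ - y₁ = ξ)
    (h₂ : w y₂ - y₂ = η) : inner ℝ y₁ η + inner ℝ y₂ ξ = - inner ℝ ξ η := by
  have h := w.inner_map_map y₁ y₂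
  rw [sub_eq_iff_eq_add.1 h₁, sub_eq_iff_eq_add.1 h₂] at h
  simp only [inner_add_left, inner_add_right] at h
  have := real_inner_comm y₂ ξ
  linarith

variable [FiniteDimensional ℝ V]

theorem rk_mul_le (g h : V ≃ₗᵢ[ℝ] V) : rk (g * h) ≤ rk g + rk h := by
  have h1 := Submodule.finrank_mono (mov_mul_le g h)
  have h2 := Submodule.finrank_add_le_finrank_add_finrank (mov g) (mov h)
  exact h1.trans h2

theorem rk_eq_zero {g : V ≃ₗᵢ[ℝ] V} : rk g = 0 ↔ g = 1 := by
  constructor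
  · intro h
    exact mov_eq_bot (Submodule.finrank_eq_zero.1 h)
  · rintro rfl; exact rk_one

theorem rk_add_finrank_fixSpace (g : V ≃ₗᵢ[ℝ] V) :
    rk g + Module.finrank ℝ (fixSpace g) = Module.finrank ℝ V :=
  LinearMap.finrank_range_add_finrank_ker _

omit [FiniteDimensional ℝ V] in
theorem fixSpace_inf_le (u w : V ≃ₗᵢ[ℝ] V) : fixSpace u ⊓ fixSpace (u⁻¹ * w) ≤ fixSpace w := by
  rintro x ⟨h1, h2⟩
  rw [SetLike.mem_coe, mem_fixSpace] at h1 h2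
  rw [mem_fixSpace]
  have : w x = u ((u⁻¹ * w) x) := (u.apply_symm_apply (w x)).symm
  rw [this, h2, h1]

omit [FiniteDimensional ℝ V] in
theorem mem_fixSpace_inv_mul {u w : V ≃ₗᵢ[ℝ] V} {y : V} :
    y ∈ fixSpace (u⁻¹ * w) ↔ w y = u y := by
  rw [mem_fixSpace]
  constructor
  · intro h
    have : w y = u ((u⁻¹ * w) y) := (u.apply_symm_apply (w y)).symm
    rw [this, h]
  · intro h
    change u⁻¹ (w y) = y
    rw [h]; exact u.symm_apply_apply y

/-- The order on isometries in terms of common preimages of the vectors of the moved space. -/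
theorem below_iff {u w : V ≃ₗᵢ[ℝ] V} :
    Below u w ↔ ∀ ξ ∈ mov u, ∃ y, u y - y = ξ ∧ w y - y = ξ := by
  have hu := rk_add_finrank_fixSpace u
  have hv := rk_add_finrank_fixSpace (u⁻¹ * w)
  have hw := rk_add_finrank_fixSpace w
  have hs := Submodule.finrank_sup_add_finrank_inf_eq (fixSpace u) (fixSpace (u⁻¹ * w))
  constructor
  · intro h ξ hξ
    have hi := Submodule.finrank_mono (fixSpace_inf_le u w)
    have hle := Submodule.finrank_le (fixSpace u ⊔ fixSpace (u⁻¹ * w))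
    unfold Below at h
    -- Rank-nullity turns `Below` into a lower bound on the dimension of this sum, because the
    -- intersection lies in `fixSpace w`.
    have htop : fixSpace u ⊔ fixSpace (u⁻¹ * w) = ⊤ :=
      Submodule.eq_top_of_finrank_eq (by omega)
    obtain ⟨x, rfl⟩ := mem_mov.1 hξ
    have hx : x ∈ fixSpace u ⊔ fixSpace (u⁻¹ * w) := htop ▸ Submodule.mem_top
    obtain ⟨f, hf, y, hy, rfl⟩ := Submodule.mem_sup.1 hx
    rw [mem_fixSpace] at hf
    rw [mem_fixSpace_inv_mul] at hy
    refine ⟨y, ?_, ?_⟩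
    · rw [map_add, hf]; abel
    · rw [map_add, hf, hy]; abel
  · intro h
    have hm : mov u ≤ mov w := fun ξ hξ => by
      obtain ⟨y, -, hy⟩ := h ξ hξ
      exact mem_mov.2 ⟨y, hy⟩
    have htop : fixSpace u ⊔ fixSpace (u⁻¹ * w) = ⊤ := by
      rw [eq_top_iff]
      intro x _
      obtain ⟨y, hy1, hy2⟩ := h _ (sub_mem_mov u x)
      refine Submodule.mem_sup.2 ⟨x - y, ?_, y, ?_, by abel⟩
      · rw [mem_fixSpace, map_sub]
        rw [sub_eq_sub_iff_add_eq_add] at hy1 ⊢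
        rw [← hy1, add_comm]
      · rw [mem_fixSpace_inv_mul]
        exact sub_left_injective (hy2.trans hy1.symm)
    have hinf : fixSpace u ⊓ fixSpace (u⁻¹ * w) = fixSpace w := by
      refine le_antisymm (fixSpace_inf_le u w) fun x hx => ?_
      rw [mem_fixSpace] at hx
      have hux := fixed_of_mov_le hm hx
      exact ⟨mem_fixSpace.2 hux, mem_fixSpace_inv_mul.2 (hx.trans hux.symm)⟩
    rw [htop, hinf, finrank_top] at hs
    unfold Below
    omega

theorem Below.mov_le {u w : V ≃ₗᵢ[ℝ] V} (h : Below u w) : mov u ≤ mov w := fun ξ hξ => by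
  obtain ⟨y, -, hy⟩ := below_iff.1 h ξ hξ
  exact mem_mov.2 ⟨y, hy⟩

/-- A common preimage for `u` and `w` and one for `v` and `w` differ by a vector fixed by `w`, hence
by `v`. So the first is also a preimage for `v`. -/
theorem below_of_mov_le {u v w : V ≃ₗᵢ[ℝ] V} (hu : Below u w) (hv : Below v w)
    (h : mov u ≤ mov v) : Below u v := by
  rw [below_iff]
  intro ξ hξ
  obtain ⟨y, h1, h2⟩ := below_iff.1 hu ξ hξ
  obtain ⟨y', h3, h4⟩ := below_iff.1 hv ξ (h hξ)
  have hf : w (y - y') = y - y' := by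
    rw [map_sub, sub_eq_iff_eq_add.1 h2, sub_eq_iff_eq_add.1 h4]; abel
  have := fixed_of_mov_le hv.mov_le hf
  refine ⟨y, h1, ?_⟩
  rw [← h3]
  rw [map_sub] at this
  rw [sub_eq_sub_iff_add_eq_add] at this ⊢
  rw [this, add_comm]

theorem Below.trans {u v w : V ≃ₗᵢ[ℝ] V} (h₁ : Below u v) (h₂ : Below v w) : Below u w := by
  unfold Below at *
  have h3 := rk_mul_le (u⁻¹ * v) (v⁻¹ * w)
  have h4 := rk_mul_le u (u⁻¹ * w)
  rw [show u⁻¹ * v * (v⁻¹ * w) = u⁻¹ * w by group] at h3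
  rw [show u * (u⁻¹ * w) = w by group] at h4
  omega

theorem Below.inv_mul_inv_mul {u v w : V ≃ₗᵢ[ℝ] V} (h₁ : Below u v) (h₂ : Below v w) :
    Below (u⁻¹ * v) (u⁻¹ * w) := by
  have h := h₁.trans h₂
  unfold Below at *
  rw [show (u⁻¹ * v)⁻¹ * (u⁻¹ * w) = v⁻¹ * w by group]
  omega

theorem Below.of_inv_mul {u v w : V ≃ₗᵢ[ℝ] V} (hu : Below u w) (h : Below v (u⁻¹ * w)) :
    Below (u * v) w ∧ Below u (u * v) := by
  unfold Below at *
  have h1 := rk_mul_le u v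
  have h2 := rk_mul_le (u * v) ((u * v)⁻¹ * w)
  rw [show (u * v) * ((u * v)⁻¹ * w) = w by group] at h2
  rw [show (u * v)⁻¹ * w = v⁻¹ * (u⁻¹ * w) by group] at *
  rw [show u⁻¹ * (u * v) = v by group]
  omega

omit [FiniteDimensional ℝ V] in
theorem Below.inv_mul_below {u w : V ≃ₗᵢ[ℝ] V} (h : Below u w) : Below (u⁻¹ * w) w := by
  unfold Below at *
  rw [show (u⁻¹ * w)⁻¹ * w = w⁻¹ * u * w⁻¹⁻¹ by group, rk_conj]
  omega

theorem Below.antisymm {u v : V ≃ₗᵢ[ℝ] V} (h₁ : Below u v) (h₂ : mov v ≤ mov u) : u = v := by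
  have h3 := Submodule.finrank_mono h₂
  unfold Below rk at h₁
  have : rk (u⁻¹ * v) = 0 := by unfold rk; omega
  exact (inv_mul_eq_one.1 (rk_eq_zero.1 this))

omit [FiniteDimensional ℝ V] in
theorem below_refl (u : V ≃ₗᵢ[ℝ] V) : Below u u := by
  simp [Below, rk_one]

omit [FiniteDimensional ℝ V] in
theorem one_below (u : V ≃ₗᵢ[ℝ] V) : Below 1 u := by
  simp [Below, rk_one]

/-- The bilinear form `⟨(w - 1)⁻¹ ξ, η⟩` restricts to the corresponding form of `u ≤ w`. -/
theorem Below.inner_preimage_eq {u w : V ≃ₗᵢ[ℝ] V} (h : Below u w) {y y' ξ η : V}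
    (hy : w y - y = ξ) (hy' : u y' - y' = ξ) (hη : η ∈ mov u) :
    inner ℝ y η = inner ℝ y' η := by
  obtain ⟨z, h1, h2⟩ := below_iff.1 h ξ (mem_mov.2 ⟨y', hy'⟩)
  have hf : w (y - z) = y - z := by
    rw [map_sub, sub_eq_iff_eq_add.1 hy, sub_eq_iff_eq_add.1 h2]; abel
  have hf' : u (y' - z) = y' - z := by
    rw [map_sub, sub_eq_iff_eq_add.1 hy', sub_eq_iff_eq_add.1 h1]; abel
  have e1 := inner_mov_fixSpace (h.mov_le hη) hf
  have e2 := inner_mov_fixSpace hη hf'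
  rw [real_inner_comm, inner_sub_left] at e1 e2
  linarith

/-- `t` is the orthogonal reflection with root `α`. -/
def IsReflectionAlong (t : V ≃ₗᵢ[ℝ] V) (α : V) : Prop :=
  α ≠ 0 ∧ t = (ℝ ∙ α)ᗮ.reflection

omit [FiniteDimensional ℝ V] in
theorem IsReflectionAlong.apply {t : V ≃ₗᵢ[ℝ] V} {α : V} (ht : IsReflectionAlong t α) (y : V) :
    t y = y - (2 * inner ℝ α y / inner ℝ α α) • α := by
  rw [ht.2, Submodule.reflection_orthogonal_apply, Submodule.reflection_singleton_apply]
  rw [real_inner_self_eq_norm_sq]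
  simp [two_smul, ← add_smul]
  rw [mul_div_assoc, two_mul]

omit [FiniteDimensional ℝ V] in
theorem IsReflectionAlong.mov_eq {t : V ≃ₗᵢ[ℝ] V} {α : V} (ht : IsReflectionAlong t α) :
    mov t = ℝ ∙ α := by
  apply le_antisymm
  · intro x hx
    obtain ⟨y, rfl⟩ := mem_mov.1 hx
    rw [ht.apply]
    refine Submodule.mem_span_singleton.2 ⟨-(2 * inner ℝ α y / inner ℝ α α), ?_⟩
    simp
  · rw [Submodule.span_singleton_le_iff_mem]
    refine mem_mov.2 ⟨(-(1/2 : ℝ)) • α, ?_⟩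
    have h0 : inner ℝ α α ≠ 0 := by simpa using ht.1
    rw [ht.apply, inner_smul_right, sub_right_comm, sub_self, zero_sub, ← neg_smul]
    rw [show -(2 * (-(1/2) * inner ℝ α α) / inner ℝ α α) = (1 : ℝ) by field_simp, one_smul]

omit [FiniteDimensional ℝ V] in
theorem IsReflectionAlong.rk_eq {t : V ≃ₗᵢ[ℝ] V} {α : V} (ht : IsReflectionAlong t α) :
    rk t = 1 := by
  rw [rk, ht.mov_eq]
  exact finrank_span_singleton ht.1

omit [FiniteDimensional ℝ V] in
theorem IsReflectionAlong.inv_eq {t : V ≃ₗᵢ[ℝ] V} {α : V} (ht : IsReflectionAlong t α) :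
    t⁻¹ = t := by
  rw [ht.2]; exact Submodule.reflection_inv

theorem IsReflectionAlong.below_iff {t w : V ≃ₗᵢ[ℝ] V} {α : V} (ht : IsReflectionAlong t α) :
    Below t w ↔ α ∈ mov w := by
  constructor
  · intro h
    apply h.mov_le
    rw [ht.mov_eq]; exact Submodule.mem_span_singleton_self α
  · intro h
    obtain ⟨y, hy⟩ := mem_mov.1 h
    rw [_root_.below_iff]
    intro ξ hξ
    rw [ht.mov_eq] at hξ
    obtain ⟨c, rfl⟩ := Submodule.mem_span_singleton.1 hξ
    refine ⟨c • y, ?_, by rw [map_smul, ← smul_sub, hy]⟩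
    rw [map_smul, ← smul_sub]
    congr 1
    -- The vectors `w y` and `y` have equal norm, so the reflection along their difference `α`
    -- exchanges them: `t` moves `y` exactly as `w` does.
    have h2 : (ℝ ∙ (w y - y))ᗮ.reflection (w y) = y := by
      apply Submodule.reflection_sub
      exact w.norm_map y
    rw [hy, ← ht.2] at h2
    have h3 : t (t (w y)) = t y := by rw [h2]
    rw [ht.2, Submodule.reflection_reflection] at h3
    rw [← hy, ht.2, ← h3]

theorem IsReflectionAlong.rk_mul {t w : V ≃ₗᵢ[ℝ] V} {α : V} (ht : IsReflectionAlong t α)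
    (h : α ∈ mov w) : rk (t * w) + 1 = rk w := by
  have := ht.below_iff.2 h
  unfold Below at this
  rw [ht.inv_eq, ht.rk_eq] at this
  omega

/-- A root `β` orthogonal to `α` for the form of `w` yields `t s ≤ w`. -/
theorem IsReflectionAlong.mul_below {s t w : V ≃ₗᵢ[ℝ] V} {α β y : V}
    (hs : IsReflectionAlong s α) (ht : IsReflectionAlong t β) (hα : α ∈ mov w)
    (hy : w y - y = β) (h0 : inner ℝ y α = 0) :
    Below (t * s) w ∧ rk (t * s) = 2 := by
  -- Orthogonality of `y` and `α` means that `s` fixes `y`, so `y` remains a preimage of `β` for `w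
  -- * s`, and `t` lowers the rank once more.
  have h1 : β ∈ mov (w * s) := by
    refine mem_mov.2 ⟨y, ?_⟩
    have : s y = y := by
      rw [hs.apply, real_inner_comm, h0]; simp
    change w (s y) - y = β
    rw [this, hy]
  have h2 := ht.rk_mul h1
  have h3 : rk (w * s) + 1 = rk w := by rw [rk_mul_comm, hs.rk_mul hα]
  have h4 : rk ((t * s)⁻¹ * w) = rk (t * (w * s)) := by
    rw [mul_inv_rev, hs.inv_eq, ht.inv_eq, mul_assoc, rk_mul_comm, mul_assoc]
  have h5 := rk_mul_le t s
  rw [hs.rk_eq, ht.rk_eq] at h5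
  have h6 := rk_mul_le (t * s) ((t * s)⁻¹ * w)
  rw [show (t * s) * ((t * s)⁻¹ * w) = w by group] at h6
  unfold Below
  omega

/-- If `t s ≤ w` has rank two, then `t s` is the join of `s` and `t`. -/
theorem IsReflectionAlong.mul_isJoin {s t w : V ≃ₗᵢ[ℝ] V} {α β : V}
    (hs : IsReflectionAlong s α) (ht : IsReflectionAlong t β) (hne1 : rk (t * s) = 2)
    (h : Below (t * s) w) :
    Below s (t * s) ∧ Below t (t * s) ∧
      ∀ u, Below u w → Below s u → Below t u → Below (t * s) u := by
  refine ⟨?_, ?_, ?_⟩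
  · unfold Below
    rw [rk_mul_comm, show t * s * s⁻¹ = t by group, ht.rk_eq, hs.rk_eq, hne1]
  · unfold Below
    rw [show t⁻¹ * (t * s) = s by group, ht.rk_eq, hs.rk_eq, hne1]
  · intro u hu h1 h2
    exact below_of_mov_le h hu ((mov_mul_le t s).trans (sup_le h2.mov_le h1.mov_le))

end Isometries

/-! ### Signed points and negation. -/

namespace SignedPoint

variable {n : ℕ}

@[simp] theorem opp_opp (x : SignedPoint n) : x.opp.opp = x := by simp [opp]

theorem opp_ne (x : SignedPoint n) : x.opp ≠ x := by
  intro h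
  have := congrArg Prod.snd h
  exact units_ne_neg_self x.2 this.symm

@[simp] theorem opp_fst (x : SignedPoint n) : x.opp.1 = x.1 := rfl

theorem opp_inj {x y : SignedPoint n} : x.opp = y.opp ↔ x = y :=
  ⟨fun h => by simpa using congrArg opp h, fun h => h ▸ rfl⟩

theorem opp_eq_iff {x y : SignedPoint n} : x.opp = y ↔ x = y.opp :=
  ⟨fun h => by simp [← h], fun h => by simp [h]⟩

theorem fst_eq_iff {x y : SignedPoint n} : x.1 = y.1 ↔ x = y ∨ x = y.opp := by
  constructor
  · intro h
    by_cases h2 : x.2 = y.2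
    · exact Or.inl (Prod.ext h h2)
    · refine Or.inr (Prod.ext h ?_)
      exact Int.units_ne_iff_eq_neg.1 h2
  · rintro (rfl | rfl) <;> rfl

end SignedPoint

open SignedPoint

/-! ### Signed permutations as isometries, and their reflections. -/

section Representation

variable {n : ℕ}

theorem GroupB.map_opp (w : GroupB n) (x : SignedPoint n) : w.1 x.opp = (w.1 x).opp := w.2 x

theorem GroupB.zpow_opp (w : GroupB n) (k : ℤ) (x : SignedPoint n) :
    (w.1 ^ k) x.opp = ((w.1 ^ k) x).opp := (w ^ k).2 x

/-- The coordinate of a vector at a signed point. -/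
noncomputable def co (y : EuclideanSpace ℝ (Fin n)) (x : SignedPoint n) : ℝ :=
  ((x.2 : ℤ) : ℝ) * y x.1

@[simp] theorem co_opp (y : EuclideanSpace ℝ (Fin n)) (x : SignedPoint n) :
    co y x.opp = - co y x := by simp [co, opp]

@[simp] theorem co_add (y z : EuclideanSpace ℝ (Fin n)) (x : SignedPoint n) :
    co (y + z) x = co y x + co z x := by simp [co, mul_add]

@[simp] theorem co_sub (y z : EuclideanSpace ℝ (Fin n)) (x : SignedPoint n) :
    co (y - z) x = co y x - co z x := by simp [co, mul_sub]

@[simp] theorem co_neg (y : EuclideanSpace ℝ (Fin n)) (x : SignedPoint n) :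
    co (-y) x = - co y x := by simp [co]

@[simp] theorem co_smul (c : ℝ) (y : EuclideanSpace ℝ (Fin n)) (x : SignedPoint n) :
    co (c • y) x = c * co y x := by simp [co]; ring

@[simp] theorem co_zero (x : SignedPoint n) : co 0 x = 0 := by simp [co]

theorem co_sum {ι : Type*} (s : Finset ι) (f : ι → EuclideanSpace ℝ (Fin n)) (x : SignedPoint n) :
    co (∑ i ∈ s, f i) x = ∑ i ∈ s, co (f i) x := by
  classical
  induction s using Finset.induction_on with
  | empty => simp
  | insert a s ha ih => rw [Finset.sum_insert ha, Finset.sum_insert ha, co_add, ih]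

theorem co_ext {y z : EuclideanSpace ℝ (Fin n)} (h : ∀ x, co y x = co z x) : y = z := by
  ext i
  simpa [co] using h (i, 1)

/-- The vector whose coordinates are given by an odd function. -/
noncomputable def ofOdd (f : SignedPoint n → ℝ) : EuclideanSpace ℝ (Fin n) :=
  WithLp.toLp 2 fun i => f (i, 1)

theorem co_ofOdd {f : SignedPoint n → ℝ} (hf : ∀ x, f x.opp = - f x) (x : SignedPoint n) :
    co (ofOdd f) x = f x := by
  obtain ⟨i, s⟩ := x
  rcases Int.units_eq_one_or s with rfl | rfl
  · simp [co, ofOdd]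
  · have := hf (i, 1)
    simp only [opp] at this
    simp [co, ofOdd, this]

theorem inner_eq_sum_co (y z : EuclideanSpace ℝ (Fin n)) :
    inner ℝ y z = (1 / 2 : ℝ) * ∑ x, co y x * co z x := by
  rw [Fintype.sum_prod_type, PiLp.inner_apply, Finset.mul_sum]
  refine Finset.sum_congr rfl fun i _ => ?_
  have : (Finset.univ : Finset ℤˣ) = {1, -1} := rfl
  rw [this, Finset.sum_pair (by decide)]
  simp [co]; ring

/-- The action of a signed permutation on vectors. -/
noncomputable def act (w : GroupB n) (y : EuclideanSpace ℝ (Fin n)) : EuclideanSpace ℝ (Fin n) :=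
  ofOdd fun x => co y (w⁻¹.1 x)

theorem co_act (w : GroupB n) (y : EuclideanSpace ℝ (Fin n)) (x : SignedPoint n) :
    co (act w y) x = co y (w⁻¹.1 x) :=
  co_ofOdd (f := fun x => co y (w⁻¹.1 x)) (fun x => by rw [GroupB.map_opp, co_opp]) x

theorem act_mul (u v : GroupB n) (y : EuclideanSpace ℝ (Fin n)) :
    act (u * v) y = act u (act v y) := co_ext fun x => by
  rw [co_act, co_act, co_act, mul_inv_rev]; rfl

theorem act_one (y : EuclideanSpace ℝ (Fin n)) : act (1 : GroupB n) y = y :=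
  co_ext fun x => by rw [co_act, inv_one]; rfl

/-- The linear isometry attached to a signed permutation. -/
noncomputable def rep : GroupB n →* (EuclideanSpace ℝ (Fin n) ≃ₗᵢ[ℝ] EuclideanSpace ℝ (Fin n)) where
  toFun w :=
    { toFun := act w
      invFun := act w⁻¹
      map_add' := fun y z => co_ext fun x => by simp only [co_act, co_add]
      map_smul' := fun c y => co_ext fun x => by simp only [co_act, co_smul, RingHom.id_apply]
      left_inv := fun y => by rw [← act_mul, inv_mul_cancel, act_one]
      right_inv := fun y => by rw [← act_mul, mul_inv_cancel, act_one]
      norm_map' := fun y => by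
        rw [← sq_eq_sq₀ (norm_nonneg _) (norm_nonneg _), ← real_inner_self_eq_norm_sq,
          ← real_inner_self_eq_norm_sq, inner_eq_sum_co, inner_eq_sum_co]
        congr 1
        refine Fintype.sum_equiv w⁻¹.1 _ _ fun x => ?_
        change co (act w y) x * co (act w y) x = _
        rw [co_act] }
  map_one' := by
    ext1 y
    exact act_one y
  map_mul' u v := by
    ext1 y
    exact act_mul u v y

theorem co_rep (w : GroupB n) (y : EuclideanSpace ℝ (Fin n)) (x : SignedPoint n) :
    co (rep w y) x = co y (w.1⁻¹ x) := co_act w y x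

/-- The signed basis vector at a signed point. -/
noncomputable def bv (a : SignedPoint n) : EuclideanSpace ℝ (Fin n) :=
  ofOdd fun x => if x = a then 1 else if x = a.opp then -1 else 0

theorem co_bv (a x : SignedPoint n) :
    co (bv a) x = if x = a then 1 else if x = a.opp then -1 else 0 := by
  refine co_ofOdd (fun x => ?_) x
  have h1 : x.opp = a ↔ x = a.opp := opp_eq_iff
  have h2 : x.opp = a.opp ↔ x = a := opp_inj
  simp only [h1, h2]
  by_cases h : x = a
  · subst h; simp [(opp_ne x).symm]
  · by_cases h' : x = a.opp <;> simp [h, h', opp_ne]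

theorem co_bv_self (a : SignedPoint n) : co (bv a) a = 1 := by simp [co_bv]

theorem co_bv_of_ne {a x : SignedPoint n} (h : x.1 ≠ a.1) : co (bv a) x = 0 := by
  have := mt fst_eq_iff.2 h
  push Not at this
  simp [co_bv, this]

theorem bv_opp (a : SignedPoint n) : bv a.opp = - bv a := co_ext fun x => by
  simp only [co_bv, co_neg, opp_opp]
  by_cases h : x = a
  · subst h; simp [(opp_ne x).symm]
  · by_cases h' : x = a.opp <;> simp [h, h', opp_ne]

theorem inner_bv (y : EuclideanSpace ℝ (Fin n)) (a : SignedPoint n) :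
    inner ℝ y (bv a) = co y a := by
  rw [inner_eq_sum_co]
  have : ∀ x, co y x * co (bv a) x
      = (if x = a then co y a else 0) + (if x = a.opp then co y a else 0) := by
    intro x
    rw [co_bv]
    by_cases h : x = a
    · subst h; simp [(opp_ne x).symm]
    · by_cases h' : x = a.opp <;> simp [h, h']
      simp [opp_ne]
  rw [Finset.sum_congr rfl fun x _ => this x, Finset.sum_add_distrib]
  simp
  ring

theorem rep_bv (w : GroupB n) (a : SignedPoint n) : rep w (bv a) = bv (w.1 a) :=
  co_ext fun x => by
    rw [co_rep, co_bv, co_bv, ← GroupB.map_opp]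
    simp only [Equiv.Perm.inv_eq_iff_eq]

theorem bv_injective : Function.Injective (bv (n := n)) := by
  intro a b h
  have := co_bv_self a
  rw [h, co_bv] at this
  by_contra hne
  rw [if_neg hne] at this
  split_ifs at this <;> norm_num at this

theorem rep_injective : Function.Injective (rep (n := n)) := by
  intro u v h
  ext1
  ext1 a
  apply bv_injective
  rw [← rep_bv, ← rep_bv, h]

theorem bv_sub_ne_zero {a b : SignedPoint n} (h : a ≠ b) : bv a - bv b ≠ 0 := fun h0 =>
  h (bv_injective (sub_eq_zero.1 h0))

/-- The involution exchanging `a` and `b`, and their opposites. -/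
def reflFun (a b x : SignedPoint n) : SignedPoint n :=
  if x = a then b else if x = b then a else if x = a.opp then b.opp else
    if x = b.opp then a.opp else x

theorem reflFun_involutive (a b : SignedPoint n) : Function.Involutive (reflFun a b) := by
  intro x
  have h1 := opp_ne a
  have h2 := opp_ne b
  have h3 := opp_opp a
  have h4 := opp_opp b
  unfold reflFun
  grind

theorem reflFun_opp (a b x : SignedPoint n) : reflFun a b x.opp = (reflFun a b x).opp := by
  have h1 := opp_ne a
  have h2 := opp_ne b
  have h3 := opp_opp a
  have h4 := opp_opp b
  have h5 := opp_opp x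
  unfold reflFun
  grind

/-- The reflection of `B_n` exchanging `a` and `b`. -/
def reflB (a b : SignedPoint n) : GroupB n :=
  ⟨(reflFun_involutive a b).toPerm, reflFun_opp a b⟩

theorem reflB_apply (a b x : SignedPoint n) : (reflB a b).1 x = reflFun a b x := rfl

theorem reflB_inv_apply (a b x : SignedPoint n) : (reflB a b).1⁻¹ x = reflFun a b x := by
  rw [Equiv.Perm.inv_eq_iff_eq, reflB_apply, reflFun_involutive]

theorem reflB_eq_swap (a : SignedPoint n) : (reflB a a.opp).1 = Equiv.swap a a.opp := by
  ext1 x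
  rw [reflB_apply, reflFun, Equiv.swap_apply_def]
  have h1 := opp_ne a
  have h3 := opp_opp a
  grind

theorem reflB_eq_swap_mul_swap {a b : SignedPoint n} (h : a.1 ≠ b.1) :
    (reflB a b).1 = Equiv.swap a b * Equiv.swap a.opp b.opp := by
  ext1 x
  rw [reflB_apply, reflFun, Equiv.Perm.mul_apply, Equiv.swap_apply_def, Equiv.swap_apply_def]
  have h1 := opp_ne a
  have h2 := opp_ne b
  have h3 := opp_opp a
  have h4 := opp_opp b
  have h5 := fst_eq_iff (x := a) (y := b)
  grind

theorem balancedPerm_singleton (a : SignedPoint n) : balancedPerm [a] = (reflB a a.opp).1 := by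
  rw [reflB_eq_swap]
  simp [balancedPerm]

theorem pairedPerm_pair {a b : SignedPoint n} (h : a.1 ≠ b.1) :
    pairedPerm [a, b] = (reflB a b).1 := by
  rw [reflB_eq_swap_mul_swap h]
  simp [pairedPerm]

theorem sign_reflB_opp (a : SignedPoint n) : Equiv.Perm.sign (reflB a a.opp).1 = -1 := by
  rw [reflB_eq_swap, Equiv.Perm.sign_swap (opp_ne a).symm]

theorem sign_reflB {a b : SignedPoint n} (h : a.1 ≠ b.1) :
    Equiv.Perm.sign (reflB a b).1 = 1 := by
  have h1 : a ≠ b := fun h' => h (h' ▸ rfl)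
  have h2 : a.opp ≠ b.opp := fun h' => h (opp_inj.1 h' ▸ rfl)
  rw [reflB_eq_swap_mul_swap h, map_mul, Equiv.Perm.sign_swap h1, Equiv.Perm.sign_swap h2]
  rfl

theorem reflB_comm (a b : SignedPoint n) : reflB a b = reflB b a := by
  ext1; ext1 x
  rw [reflB_apply, reflB_apply, reflFun, reflFun]
  have h1 := opp_ne a
  have h2 := opp_ne b
  have h3 := opp_opp a
  have h4 := opp_opp b
  grind

theorem reflB_opp_opp (a b : SignedPoint n) : reflB a.opp b.opp = reflB a b := by
  ext1; ext1 x
  rw [reflB_apply, reflB_apply, reflFun, reflFun]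
  have h1 := opp_ne a
  have h2 := opp_ne b
  have h3 := opp_opp a
  have h4 := opp_opp b
  grind

theorem isReflectionAlong_reflB {a b : SignedPoint n} (h : a ≠ b) :
    IsReflectionAlong (rep (reflB a b)) (bv a - bv b) := by
  have h0 := bv_sub_ne_zero h
  refine ⟨h0, ?_⟩
  have h0' : inner ℝ (bv a - bv b) (bv a - bv b) ≠ 0 := by simpa using h0
  have hr : IsReflectionAlong (ℝ ∙ (bv a - bv b))ᗮ.reflection (bv a - bv b) := ⟨h0, rfl⟩
  ext1 y
  refine co_ext fun x => ?_
  rw [hr.apply, co_rep, reflB_inv_apply, reflFun]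
  simp only [co_sub, co_smul, inner_sub_right, inner_bv, co_bv]
  rw [real_inner_comm, inner_sub_right, inner_bv, inner_bv]
  have h1 := opp_ne a
  have h2 := opp_ne b
  have h3 := opp_opp a
  have h4 := opp_opp b
  have e1 := co_opp y a
  have e2 := co_opp y b
  -- For `b = -a` the root is twice a basis vector and the two coordinates are no longer
  -- independent.
  by_cases hab : a = b.opp
  · subst hab
    have h6 := (opp_ne b).symm
    simp only [opp_opp, h6, opp_ne, if_true, if_false, co_opp]
    split_ifs <;> simp_all <;> ring
  · have hba : b ≠ a.opp := fun h' => hab (by rw [h', opp_opp])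
    have hoo : a.opp ≠ b.opp := fun h' => h (opp_inj.1 h')
    simp only [h, h.symm, hab, hba, if_true, if_false]
    split_ifs <;> simp_all <;> ring

end Representation

/-! ### Cycles, moved spaces and values of the form. -/

section Orbits

variable {n : ℕ}

open Equiv.Perm

/-- The signed point `x` lies in a balanced cycle of `w`. -/
def Bal (w : GroupB n) (x : SignedPoint n) : Prop := w.1.SameCycle x x.opp

theorem sameCycle_opp {w : GroupB n} {x y : SignedPoint n} (h : w.1.SameCycle x y) :
    w.1.SameCycle x.opp y.opp := by
  obtain ⟨k, rfl⟩ := h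
  exact ⟨k, GroupB.zpow_opp w k x⟩

theorem sameCycle_opp_left {w : GroupB n} {x y : SignedPoint n} :
    w.1.SameCycle x.opp y ↔ w.1.SameCycle x y.opp :=
  ⟨fun h => by simpa using sameCycle_opp h, fun h => by simpa using sameCycle_opp h⟩

theorem Bal.of_sameCycle {w : GroupB n} {x y : SignedPoint n} (hx : Bal w x)
    (h : w.1.SameCycle x y) : Bal w y :=
  h.symm.trans (Equiv.Perm.SameCycle.trans hx (sameCycle_opp h))

theorem bal_opp {w : GroupB n} {x : SignedPoint n} : Bal w x.opp ↔ Bal w x := by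
  unfold Bal
  rw [sameCycle_opp_left, opp_opp]

theorem rep_preimage_co {w : GroupB n} {h ξ : EuclideanSpace ℝ (Fin n)} (hh : rep w h - h = ξ)
    (z : SignedPoint n) : co h (w.1⁻¹ z) = co h z + co ξ z := by
  rw [← hh, co_sub, co_rep]; ring

/-- Sum the basis vectors along the orbit from `y` up to, but not including, `x`; applying `w - 1`
telescopes. -/
theorem exists_segment {w : GroupB n} {x y : SignedPoint n} (h : w.1.SameCycle y x) :
    ∃ g, rep w g - g = bv x - bv y ∧
      ∀ z, ¬ w.1.SameCycle y z → ¬ w.1.SameCycle y z.opp → co g z = 0 := by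
  obtain ⟨k, rfl⟩ := h.exists_nat_pow_eq
  refine ⟨∑ i ∈ Finset.range k, bv ((w.1 ^ i) y), ?_, ?_⟩
  · rw [map_sum, ← Finset.sum_sub_distrib]
    have : ∀ i ∈ Finset.range k, rep w (bv ((w.1 ^ i) y)) - bv ((w.1 ^ i) y)
        = bv ((w.1 ^ (i + 1)) y) - bv ((w.1 ^ i) y) := fun i _ => by
      rw [rep_bv, pow_succ', mul_apply]
    rw [Finset.sum_congr rfl this, Finset.sum_range_sub (fun i => bv ((w.1 ^ i) y))]
    simp
  · intro z h1 h2
    rw [co_sum]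
    refine Finset.sum_eq_zero fun i _ => co_bv_of_ne fun h3 => ?_
    rcases fst_eq_iff.1 h3 with rfl | rfl
    · exact h1 ⟨i, by simp⟩
    · exact h2 ⟨i, by simp⟩

/-- The segment from `x` to `-x` is a preimage of `-2 bv x`. -/
theorem exists_bal_preimage {w : GroupB n} {x : SignedPoint n} (h : Bal w x) :
    ∃ g, rep w g - g = bv x ∧ ∀ z, ¬ w.1.SameCycle x z → co g z = 0 := by
  obtain ⟨g, hg, h0⟩ := exists_segment h
  refine ⟨(-(1/2) : ℝ) • g, ?_, ?_⟩
  · rw [map_smul, ← smul_sub, hg, bv_opp]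
    module
  · intro z hz
    rw [co_smul, h0 z hz, mul_zero]
    intro h1
    exact hz (Equiv.Perm.SameCycle.trans h (by simpa using sameCycle_opp h1))

open Classical in
/-- The difference of the indicator functions of the cycles of `x` and `-x`. -/
noncomputable def orbitVec (w : GroupB n) (x : SignedPoint n) : EuclideanSpace ℝ (Fin n) :=
  ofOdd fun z => (if w.1.SameCycle x z then 1 else 0) - (if w.1.SameCycle x.opp z then 1 else 0)

open Classical in
theorem co_orbitVec (w : GroupB n) (x z : SignedPoint n) : co (orbitVec w x) z =
    (if w.1.SameCycle x z then 1 else 0) - (if w.1.SameCycle x.opp z then 1 else 0) := by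
  refine co_ofOdd (f := fun z => (if w.1.SameCycle x z then (1 : ℝ) else 0)
    - (if w.1.SameCycle x.opp z then 1 else 0)) (fun z => ?_) z
  simp only [sameCycle_opp_left, opp_opp]
  ring

theorem rep_orbitVec (w : GroupB n) (x : SignedPoint n) : rep w (orbitVec w x) = orbitVec w x :=
  co_ext fun z => by
    rw [co_rep, co_orbitVec, co_orbitVec]
    simp only [show w.1⁻¹ z = w.1.symm z from rfl, sameCycle_symm_apply_right]

/-- The vector `orbitVec w x` is fixed by `w`, hence orthogonal to `mov w`, but for non-balanced `x`
its coordinate at `x` is `1`. -/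
theorem bv_mem_mov_iff {w : GroupB n} {x : SignedPoint n} : bv x ∈ mov (rep w) ↔ Bal w x := by
  constructor
  · intro h
    have := inner_mov_fixSpace h (rep_orbitVec w x)
    rw [real_inner_comm, inner_bv, co_orbitVec, if_pos (SameCycle.refl _ _)] at this
    by_contra h'
    rw [if_neg (fun h3 => h' h3.symm)] at this
    norm_num at this
  · intro h
    obtain ⟨g, hg, -⟩ := exists_bal_preimage h
    exact mem_mov.2 ⟨g, hg⟩

theorem bv_sub_mem_mov_iff {w : GroupB n} {x y : SignedPoint n} :
    bv x - bv y ∈ mov (rep w) ↔ w.1.SameCycle x y ∨ (Bal w x ∧ Bal w y) := by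
  constructor
  · intro h
    have key : ∀ x y, bv x - bv y ∈ mov (rep w) → ¬ Bal w x → w.1.SameCycle x y := by
      intro x y h hx
      have := inner_mov_fixSpace h (rep_orbitVec w x)
      rw [real_inner_comm, inner_sub_right, inner_bv, inner_bv, co_orbitVec, co_orbitVec,
        if_pos (SameCycle.refl _ _), if_neg (fun h3 => hx h3.symm)] at this
      by_contra h'
      rw [if_neg h'] at this
      split_ifs at this <;> norm_num at this
    by_cases hx : Bal w x
    · by_cases hy : Bal w y
      · exact Or.inr ⟨hx, hy⟩
      · refine Or.inl (key y x ?_ hy).symm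
        rw [← neg_sub]; exact neg_mem h
    · exact Or.inl (key x y h hx)
  · rintro (h | ⟨hx, hy⟩)
    · obtain ⟨g, hg, -⟩ := exists_segment h.symm
      exact mem_mov.2 ⟨g, hg⟩
    · exact sub_mem (bv_mem_mov_iff.2 hx) (bv_mem_mov_iff.2 hy)

theorem bal_preimage_self {w : GroupB n} {x : SignedPoint n} {h : EuclideanSpace ℝ (Fin n)}
    (hh : rep w h - h = bv x) : co h x = -(1 / 2) := by
  have := inner_preimage_add hh hh
  rw [inner_bv, inner_bv, co_bv_self] at this
  linarith

/-- Going backwards along the cycle, the coordinate changes only at `x`, by `+1`, and at `-x`, by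
`-1`. It starts from `-1/2` at `x`, so it alternates between two values. -/
theorem bal_preimage_sq {w : GroupB n} {x z : SignedPoint n} {h : EuclideanSpace ℝ (Fin n)}
    (hh : rep w h - h = bv x) (hz : w.1.SameCycle x z) : co h z = 1 / 2 ∨ co h z = -(1 / 2) := by
  obtain ⟨k, hk⟩ := hz.inv.exists_nat_pow_eq
  have h0 := bal_preimage_self hh
  induction k generalizing z with
  | zero => right; rw [← hk]; simpa using h0
  | succ k ih =>
    rw [pow_succ', mul_apply] at hk
    rw [← hk, rep_preimage_co hh, co_bv]
    rcases ih (z := (w.1⁻¹ ^ k) x) ⟨-(k : ℤ), by simp⟩ rfl with h1 | h1 <;> split_ifs with h2 h3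
    · rw [h2, h0] at h1; norm_num at h1
    · right; rw [h1]; norm_num
    · left; rw [h1]; norm_num
    · left; rw [h1]; norm_num
    · rw [h3, co_opp, h0] at h1; norm_num at h1
    · right; rw [h1]; norm_num

/-- Polarisation with both vectors equal to `bv x - bv y` gives the difference `1`. Along the cycle
the coordinate jumps only at `x` and at `y`, in opposite directions, so only two values occur. -/
theorem paired_preimage {w : GroupB n} {x y z : SignedPoint n} {g : EuclideanSpace ℝ (Fin n)}
    (hg : rep w g - g = bv x - bv y) (hx : ¬ Bal w x) (hxy : w.1.SameCycle x y) (hne : x ≠ y)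
    (hz : w.1.SameCycle x z) :
    co g y = co g x + 1 ∧ (co g z = co g x ∨ co g z = co g y) := by
  have hno : ∀ z, w.1.SameCycle x z → z ≠ x.opp ∧ z ≠ y.opp := by
    intro z hz
    constructor
    · rintro rfl; exact hx hz
    · rintro rfl; exact hx (hz.trans (sameCycle_opp hxy).symm)
  have e : co g y = co g x + 1 := by
    have := inner_preimage_add hg hg
    simp only [inner_sub_right, inner_bv, co_sub, co_bv] at this
    have h1 := (hno _ hxy).1
    have h2 := (hno _ (SameCycle.refl _ _)).2
    simp only [hne, hne.symm, h1, h2, if_true, if_false] at this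
    linarith
  refine ⟨e, ?_⟩
  obtain ⟨k, hk⟩ := hz.inv.exists_nat_pow_eq
  induction k generalizing z with
  | zero => left; rw [← hk]; simp
  | succ k ih =>
    rw [pow_succ', mul_apply] at hk
    have hs : w.1.SameCycle x ((w.1⁻¹ ^ k) x) := ⟨-(k : ℤ), by simp⟩
    have hn := hno _ hs
    rw [← hk, rep_preimage_co hg, co_sub, co_bv, co_bv, if_neg hn.1, if_neg hn.2]
    rcases ih hs rfl with h1 | h1 <;> split_ifs with h2 h3 h3
    · exact absurd (h2.symm.trans h3) hne
    · right; rw [h1, e]; ring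
    · rw [h3] at h1; linarith
    · left; rw [h1]; ring
    · exact absurd (h2.symm.trans h3) hne
    · rw [h2] at h1; linarith
    · left; rw [h1, e]; ring
    · right; rw [h1]; ring

/-- Restriction of the form of `w` to the balanced points below `w`. -/
theorem bal_form_eq {u w : GroupB n} (h : Below (rep u) (rep w)) {x y : SignedPoint n}
    (hx : Bal u x) (hy : Bal u y) : u.1.SameCycle x y ↔ w.1.SameCycle x y := by
  have hxw : Bal w x := bv_mem_mov_iff.1 (h.mov_le (bv_mem_mov_iff.2 hx))
  obtain ⟨g, hg, hg0⟩ := exists_bal_preimage hx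
  obtain ⟨g', hg', hg0'⟩ := exists_bal_preimage hxw
  -- The forms of `u` and `w` agree on this pair; in either element the value is `±1/2` if the
  -- points share a cycle and `0` if not.
  have := h.inner_preimage_eq hg' hg (bv_mem_mov_iff.2 hy)
  rw [inner_bv, inner_bv] at this
  constructor
  · intro h1
    by_contra h2
    rw [hg0' y h2] at this
    rcases bal_preimage_sq hg h1 with h3 | h3 <;> rw [h3] at this <;> norm_num at this
  · intro h1
    by_contra h2
    rw [hg0 y h2] at this
    rcases bal_preimage_sq hg' h1 with h3 | h3 <;> rw [h3] at this <;> norm_num at this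

theorem Bal.of_below {u w : GroupB n} (h : Below (rep u) (rep w)) {x : SignedPoint n}
    (hx : Bal u x) : Bal w x := bv_mem_mov_iff.1 (h.mov_le (bv_mem_mov_iff.2 hx))

end Orbits

/-! ### Absolute length as rank, and `D_n` as the even signed permutations. -/

section Length

variable {n : ℕ}

open Equiv.Perm

/-- The bound `h2` shows that no word is shorter than `f w`; the descent `h3`, undone by the
involutions, builds a word of that length. -/
theorem absLength_eq_of_rank {W : Type*} [Group W] {T : Set W} {f : W → ℕ} (h1 : f 1 = 0)
    (h2 : ∀ t ∈ T, ∀ x, f (t * x) ≤ f x + 1) (h3 : ∀ x, x ≠ 1 → ∃ t ∈ T, f (t * x) + 1 = f x)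
    (hinv : ∀ t ∈ T, t * t = 1) (w : W) : absLength T w = f w := by
  have lower : ∀ l : List W, (∀ t ∈ l, t ∈ T) → f l.prod ≤ l.length := by
    intro l
    induction l with
    | nil => intro _; simp [h1]
    | cons t l ih =>
      intro hl
      rw [List.prod_cons, List.length_cons]
      exact (h2 t (hl t (by simp)) _).trans
        (Nat.succ_le_succ (ih fun s hs => hl s (List.mem_cons_of_mem _ hs)))
  have upper : ∀ k, ∀ x, f x = k → ∃ l : List W, l.length = k ∧ (∀ t ∈ l, t ∈ T) ∧ l.prod = x := by
    intro k
    induction k with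
    | zero =>
      intro x hx
      refine ⟨[], rfl, by simp, ?_⟩
      by_contra hne
      obtain ⟨t, -, ht⟩ := h3 x (fun h => hne h.symm)
      omega
    | succ k ih =>
      intro x hx
      obtain ⟨t, htT, ht⟩ := h3 x (by rintro rfl; omega)
      obtain ⟨l, hl1, hl2, hl3⟩ := ih (t * x) (by omega)
      refine ⟨t :: l, by simp [hl1], ?_, ?_⟩
      · intro s hs
        rcases List.mem_cons.1 hs with rfl | hs
        · exact htT
        · exact hl2 s hs
      · rw [List.prod_cons, hl3, ← mul_assoc, hinv t htT, one_mul]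
  apply le_antisymm
  · exact Nat.sInf_le (upper _ w rfl)
  · obtain ⟨l, hl1, hl2, hl3⟩ := Nat.sInf_mem (s := {k | ∃ l : List W, l.length = k ∧
      (∀ t ∈ l, t ∈ T) ∧ l.prod = w}) ⟨_, upper _ w rfl⟩
    rw [absLength, ← hl1, ← hl3]
    exact lower l hl2

theorem reflB_mul_self (a b : SignedPoint n) : reflB a b * reflB a b = 1 := by
  ext1; ext1 x
  exact reflFun_involutive a b x

theorem reflB_mem_pairedReflections {a b : SignedPoint n} (h : a.1 ≠ b.1) :
    reflB a b ∈ pairedReflections n := by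
  wlog hlt : a.1 < b.1 generalizing a b
  · rw [reflB_comm]
    exact this h.symm (lt_of_le_of_ne (not_lt.1 hlt) h.symm)
  wlog ha : a.2 = 1 generalizing a b
  · rw [← reflB_opp_opp]
    refine this h hlt ?_
    rcases Int.units_eq_one_or a.2 with h1 | h1
    · exact absurd h1 ha
    · simp [opp, h1]
  refine ⟨a.1, b.1, hlt, ?_⟩
  have ea : a = (a.1, 1) := Prod.ext rfl ha
  rcases Int.units_eq_one_or b.2 with h1 | h1
  · left
    rw [pairedPerm_pair (by exact h), ← ea, ← h1]
  · right
    rw [pairedPerm_pair (by exact h), ← ea, ← h1]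

theorem exists_of_mem_pairedReflections {t : GroupB n} (h : t ∈ pairedReflections n) :
    ∃ a b : SignedPoint n, a.1 ≠ b.1 ∧ t = reflB a b := by
  obtain ⟨i, j, hij, h | h⟩ := h
  · exact ⟨(i, 1), (j, 1), hij.ne, Subtype.ext (h.trans (pairedPerm_pair hij.ne))⟩
  · exact ⟨(i, 1), (j, -1), hij.ne, Subtype.ext (h.trans (pairedPerm_pair hij.ne))⟩

theorem reflB_mem_reflectionsB {a b : SignedPoint n} (h : a ≠ b) : reflB a b ∈ reflectionsB n := by
  by_cases h1 : a.1 = b.1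
  · left
    have hb : b = a.opp := by
      rcases fst_eq_iff.1 h1 with h2 | h2
      · exact absurd h2 h
      · rw [h2, opp_opp]
    refine ⟨a.1, ?_⟩
    rw [hb, balancedPerm_singleton]
    rcases Int.units_eq_one_or a.2 with h2 | h2
    · rw [← h2]
    · have : ((a.1, 1) : SignedPoint n) = a.opp := by simp [opp, h2]
      rw [this, opp_opp, reflB_comm]
  · exact Or.inr (reflB_mem_pairedReflections h1)

theorem exists_of_mem_reflectionsB {t : GroupB n} (h : t ∈ reflectionsB n) :
    ∃ a b : SignedPoint n, a ≠ b ∧ t = reflB a b := by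
  rcases h with ⟨i, hi⟩ | h
  · exact ⟨(i, 1), opp (i, 1), (opp_ne _).symm, Subtype.ext (hi.trans (balancedPerm_singleton _))⟩
  · obtain ⟨a, b, h1, h2⟩ := exists_of_mem_pairedReflections h
    exact ⟨a, b, fun h3 => h1 (h3 ▸ rfl), h2⟩

theorem exists_root {w : GroupB n} (h : w ≠ 1) :
    ∃ a, w.1 a ≠ a ∧ bv (w.1 a) - bv a ∈ mov (rep w) := by
  have : ∃ a, w.1 a ≠ a := by
    by_contra! hc
    exact h (Subtype.ext (Equiv.ext hc))
  obtain ⟨a, ha⟩ := this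
  exact ⟨a, ha, by rw [← rep_bv]; exact sub_mem_mov _ _⟩

/-- This is why passing from `B_n` to `D_n` does not change the length. If `w` maps every point to
itself or its negative, it changes the sign of a set of coordinates; evenness provides two of them,
and both basis vectors lie in `mov w`. -/
theorem exists_paired_root {w : GroupB n} (h : w ≠ 1) (hs : sign w.1 = 1) :
    ∃ a b : SignedPoint n, a.1 ≠ b.1 ∧ bv a - bv b ∈ mov (rep w) := by
  by_cases hd : ∃ a, (w.1 a).1 ≠ a.1
  · obtain ⟨a, ha⟩ := hd
    exact ⟨_, _, ha, by rw [← rep_bv]; exact sub_mem_mov _ _⟩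
  push Not at hd
  have hopp : ∀ a, w.1 a ≠ a → w.1 a = a.opp := fun a ha =>
    (fst_eq_iff.1 (hd a)).resolve_left ha
  obtain ⟨a, ha, -⟩ := exists_root h
  by_cases hb : ∃ b : SignedPoint n, b.1 ≠ a.1 ∧ w.1 b ≠ b
  · obtain ⟨b, hb1, hb2⟩ := hb
    have hbal : ∀ c, w.1 c ≠ c → Bal w c := fun c hc => ⟨1, by simpa using hopp c hc⟩
    exact ⟨b, a, hb1, bv_sub_mem_mov_iff.2 (Or.inr ⟨hbal b hb2, hbal a ha⟩)⟩
  · push Not at hb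
    have hw : w.1 = (reflB a a.opp).1 := by
      rw [reflB_eq_swap]
      ext1 x
      by_cases hx : x.1 = a.1
      · rcases fst_eq_iff.1 hx with rfl | rfl
        · rw [Equiv.swap_apply_left, hopp _ ha]
        · rw [Equiv.swap_apply_right, GroupB.map_opp, hopp _ ha, opp_opp]
      · rw [hb x hx, Equiv.swap_apply_of_ne_of_ne]
        · rintro rfl; exact hx rfl
        · rintro rfl; exact hx rfl
    rw [hw, sign_reflB_opp] at hs
    exact absurd hs (by decide)

theorem rk_reflB_mul {w : GroupB n} {a b : SignedPoint n} (hab : a ≠ b)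
    (h : bv a - bv b ∈ mov (rep w)) : rk (rep (reflB a b * w)) + 1 = rk (rep w) := by
  rw [map_mul]
  exact (isReflectionAlong_reflB hab).rk_mul h

theorem absLength_reflectionsB (w : GroupB n) : absLength (reflectionsB n) w = rk (rep w) := by
  refine absLength_eq_of_rank (f := fun w => rk (rep w)) ?_ ?_ ?_ ?_ w
  · simp [rk_one]
  · intro t ht x
    obtain ⟨a, b, hab, rfl⟩ := exists_of_mem_reflectionsB ht
    rw [map_mul, add_comm, ← (isReflectionAlong_reflB hab).rk_eq]
    exact rk_mul_le _ _
  · intro x hx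
    obtain ⟨a, ha, h⟩ := exists_root hx
    exact ⟨_, reflB_mem_reflectionsB ha, rk_reflB_mul ha h⟩
  · intro t ht
    obtain ⟨a, b, hab, rfl⟩ := exists_of_mem_reflectionsB ht
    exact reflB_mul_self a b

theorem sign_of_mem_groupD {w : GroupB n} (h : w ∈ GroupD n) : sign w.1 = 1 := by
  have : GroupD n ≤ (sign.comp (GroupB n).subtype).ker := by
    rw [GroupD, Subgroup.closure_le]
    intro t ht
    obtain ⟨a, b, hab, rfl⟩ := exists_of_mem_pairedReflections ht
    exact sign_reflB hab
  exact this h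

/-- Splitting off a paired reflection lowers the rank and preserves the sign, so induction on the
rank applies. -/
theorem mem_groupD_of_sign {w : GroupB n} (h : sign w.1 = 1) : w ∈ GroupD n := by
  induction hk : rk (rep w) using Nat.strong_induction_on generalizing w with
  | _ k ih =>
    by_cases hw : w = 1
    · rw [hw]; exact one_mem _
    obtain ⟨a, b, hab, hm⟩ := exists_paired_root hw h
    have hne : a ≠ b := fun h' => hab (h' ▸ rfl)
    have h1 := rk_reflB_mul hne hm
    have h2 : reflB a b ∈ GroupD n := Subgroup.subset_closure (reflB_mem_pairedReflections hab)
    have h3 : reflB a b * w ∈ GroupD n := by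
      refine ih _ (by omega) ?_ rfl
      rw [Subgroup.coe_mul, map_mul, sign_reflB hab, h, one_mul]
    simpa using mul_mem (inv_mem h2) h3

theorem absLength_reflectionsD (w : GroupD n) :
    absLength (reflectionsD n) w = rk (rep w.1) := by
  refine absLength_eq_of_rank (f := fun w : GroupD n => rk (rep w.1)) ?_ ?_ ?_ ?_ w
  · simp [rk_one]
  · intro t ht x
    obtain ⟨a, b, hab, h⟩ := exists_of_mem_pairedReflections ht
    have hne : a ≠ b := fun h' => hab (h' ▸ rfl)
    rw [Subgroup.coe_mul, map_mul, h, add_comm, ← (isReflectionAlong_reflB hne).rk_eq]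
    exact rk_mul_le _ _
  · intro x hx
    obtain ⟨a, b, hab, h⟩ := exists_paired_root (w := x.1) (fun h => hx (Subtype.ext h))
      (sign_of_mem_groupD x.2)
    have hne : a ≠ b := fun h' => hab (h' ▸ rfl)
    have hT := reflB_mem_pairedReflections hab
    exact ⟨⟨_, Subgroup.subset_closure hT⟩, hT, rk_reflB_mul hne h⟩
  · intro t ht
    obtain ⟨a, b, hab, h⟩ := exists_of_mem_pairedReflections ht
    ext1
    rw [Subgroup.coe_mul, h]
    exact reflB_mul_self a b

theorem absLE_reflectionsD_iff {u w : GroupD n} :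
    AbsLE (reflectionsD n) u w ↔ Below (rep u.1) (rep w.1) := by
  rw [AbsLE, absLength_reflectionsD, absLength_reflectionsD, absLength_reflectionsD, Below]
  simp

end Length

/-! ### Restricting an element to a set of coordinates. -/

section Restriction

variable {n : ℕ}

/-- If `u` moves `a`, multiplying by the reflection that exchanges `u a` and `a` makes `a` fixed at
the cost of one rank. The condition `ξ j = 0` also cuts `mov u` down by at least one dimension, so
the two subspaces coincide. -/
theorem exists_deletion (u : GroupB n) (j : Fin n) : ∃ v : GroupB n, Below (rep v) (rep u) ∧
    ∀ ξ, ξ ∈ mov (rep v) ↔ ξ ∈ mov (rep u) ∧ ξ j = 0 := by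
  set a : SignedPoint n := (j, 1) with ha
  have hco : ∀ ξ : EuclideanSpace ℝ (Fin n), co ξ a = ξ j := fun ξ => by simp [co, ha]
  have hfix : ∀ v : GroupB n, v.1 a = a → ∀ ξ ∈ mov (rep v), ξ j = 0 := by
    intro v hv ξ hξ
    have := inner_mov_fixSpace hξ (f := bv a) (by rw [rep_bv, hv])
    rwa [inner_bv, hco] at this
  by_cases h : u.1 a = a
  · exact ⟨u, below_refl _, fun ξ => ⟨fun hξ => ⟨hξ, hfix u h ξ hξ⟩, fun hξ => hξ.1⟩⟩
  have hroot : bv (u.1 a) - bv a ∈ mov (rep u) := by rw [← rep_bv]; exact sub_mem_mov _ _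
  have hr := isReflectionAlong_reflB h
  have hbelow : Below (rep (reflB (u.1 a) a * u)) (rep u) := by
    have := (hr.below_iff.2 hroot).inv_mul_below
    rwa [hr.inv_eq, ← map_mul] at this
  have hva : (reflB (u.1 a) a * u).1 a = a := by
    change reflFun (u.1 a) a (u.1 a) = a
    simp [reflFun]
  let K : Submodule ℝ (EuclideanSpace ℝ (Fin n)) :=
    { carrier := {ξ | ξ ∈ mov (rep u) ∧ ξ j = 0}
      zero_mem' := ⟨zero_mem _, rfl⟩
      add_mem' := fun hx hy => ⟨add_mem hx.1 hy.1, by simp [hx.2, hy.2]⟩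
      smul_mem' := fun c x hx => ⟨Submodule.smul_mem _ c hx.1, by simp [hx.2]⟩ }
  have hle : mov (rep (reflB (u.1 a) a * u)) ≤ K := fun ξ hξ =>
    ⟨hbelow.mov_le hξ, hfix _ hva ξ hξ⟩
  -- The root `bv (u a) - bv a` has coordinate `-1` or `-2` at `a`, so it lies outside `K`.
  have hlt : K < mov (rep u) := by
    refine lt_of_le_of_ne (fun ξ hξ => hξ.1) fun heq => ?_
    rw [← heq] at hroot
    have h2 := hroot.2
    rw [← hco, co_sub, co_bv_self, co_bv, if_neg (Ne.symm h)] at h2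
    split_ifs at h2 <;> norm_num at h2
  have hrk := rk_reflB_mul h hroot
  have hK := Submodule.finrank_lt_finrank_of_lt hlt
  have heq : mov (rep (reflB (u.1 a) a * u)) = K := by
    refine Submodule.eq_of_le_of_finrank_le hle ?_
    unfold rk at hrk
    omega
  exact ⟨_, hbelow, fun ξ => by rw [heq]; rfl⟩

/-- The restriction of a signed permutation to a set of indices. -/
theorem exists_restriction (w : GroupB n) (I : Finset (Fin n)) :
    ∃ u : GroupB n, Below (rep u) (rep w) ∧
      ∀ ξ, ξ ∈ mov (rep u) ↔ ξ ∈ mov (rep w) ∧ ∀ i ∉ I, ξ i = 0 := by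
  have key : ∀ J : Finset (Fin n), ∃ u : GroupB n, Below (rep u) (rep w) ∧
      ∀ ξ, ξ ∈ mov (rep u) ↔ ξ ∈ mov (rep w) ∧ ∀ i ∈ J, ξ i = 0 := by
    intro J
    induction J using Finset.induction_on with
    | empty => exact ⟨w, below_refl _, by simp⟩
    | insert j J _ ih =>
      obtain ⟨u, hu, hu'⟩ := ih
      obtain ⟨v, hv, hv'⟩ := exists_deletion u j
      refine ⟨v, hv.trans hu, fun ξ => ?_⟩
      rw [hv', hu', Finset.forall_mem_insert]
      tauto
  obtain ⟨u, hu, hu'⟩ := key Iᶜ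
  exact ⟨u, hu, by simpa using hu'⟩

end Restriction

/-! ### Balanced cycles, the partition and the sign. -/

section Cycles

variable {n : ℕ}

open Equiv.Perm

theorem Bal.apply_ne {w : GroupB n} {x : SignedPoint n} (h : Bal w x) : w.1 x ≠ x := by
  intro hx
  have := Equiv.Perm.SameCycle.eq_of_left h hx
  exact opp_ne x this.symm

theorem cycleOf_opp {w : GroupB n} {x : SignedPoint n} (h : Bal w x) (y : SignedPoint n) :
    w.1.cycleOf x y.opp = (w.1.cycleOf x y).opp := by
  have h1 : w.1.SameCycle x y.opp ↔ w.1.SameCycle x y := by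
    rw [← sameCycle_opp_left]
    exact ⟨fun h2 => Equiv.Perm.SameCycle.trans h h2,
      fun h2 => Equiv.Perm.SameCycle.trans (Equiv.Perm.SameCycle.symm h) h2⟩
  rw [cycleOf_apply, cycleOf_apply]
  simp only [h1, GroupB.map_opp]
  split_ifs <;> rfl

open Classical in
/-- The balanced cycle of `w` through the point `x`. -/
noncomputable def balCycle (w : GroupB n) (x : SignedPoint n) : GroupB n :=
  if h : Bal w x then ⟨w.1.cycleOf x, cycleOf_opp h⟩ else 1

theorem balCycle_val {w : GroupB n} {x : SignedPoint n} (h : Bal w x) :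
    (balCycle w x).1 = w.1.cycleOf x := by rw [balCycle, dif_pos h]

theorem nodup_append_map_opp {l : List (SignedPoint n)} (hnd : (l.map Prod.fst).Nodup) :
    (l ++ l.map opp).Nodup := by
  refine List.Nodup.append hnd.of_map (hnd.of_map.map fun a b h => opp_inj.1 h) ?_
  intro a ha hb
  obtain ⟨b, hb', rfl⟩ := List.mem_map.1 hb
  have := List.inj_on_of_nodup_map hnd ha hb' rfl
  exact opp_ne b this

theorem IsBalancedCycle.exists_bal {w : GroupB n} {c : Equiv.Perm (SignedPoint n)}
    (hc : IsBalancedCycle c) (hcw : c ∈ w.1.cycleFactorsFinset) :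
    ∃ x, Bal w x ∧ c = w.1.cycleOf x := by
  obtain ⟨l, hl, hnd, rfl⟩ := hc
  have hnd' : (l ++ l.map opp).Nodup := nodup_append_map_opp hnd
  obtain ⟨a, t, rfl⟩ := List.exists_cons_of_ne_nil hl
  have hsupp : (balancedPerm (a :: t)).support = ((a :: t) ++ (a :: t).map opp).toFinset := by
    refine List.support_formPerm_of_nodup _ hnd' fun x h => ?_
    have := congrArg List.length h
    simp at this
  have ha : a ∈ (balancedPerm (a :: t)).support := by rw [hsupp]; simp
  have ha' : a.opp ∈ (balancedPerm (a :: t)).support := by rw [hsupp]; simp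
  have he := cycle_is_cycleOf ha hcw
  rw [he] at ha'
  exact ⟨a, (mem_support_cycleOf_iff.1 ha').1, he⟩

/-- Let `k` be the first exponent with `w^k x = -x`. The points `x, …, w^(k-1) x` have distinct
absolute values, and their negatives are the remaining `k` points of the orbit. -/
theorem Bal.isBalancedCycle {w : GroupB n} {x : SignedPoint n} (h : Bal w x) :
    IsBalancedCycle (w.1.cycleOf x) := by
  classical
  have hex : ∃ k : ℕ, (w.1 ^ k) x = x.opp := Equiv.Perm.SameCycle.exists_nat_pow_eq h
  set k := Nat.find hex with hk
  have hkx : (w.1 ^ k) x = x.opp := Nat.find_spec hex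
  have hmin : ∀ m < k, (w.1 ^ m) x ≠ x.opp := fun m hm => Nat.find_min hex hm
  have hpowopp : ∀ m y, (w.1 ^ m) (opp y) = opp ((w.1 ^ m) y) := fun m y => (w ^ m).2 y
  have hk0 : k ≠ 0 := by
    intro h0
    rw [h0] at hkx
    exact opp_ne x hkx.symm
  have hret : ∀ d, 0 < d → d < k → (w.1 ^ d) x ≠ x ∧ (w.1 ^ d) x ≠ x.opp := by
    intro d hd hdk
    refine ⟨fun hdx => ?_, hmin d hdk⟩
    -- A return to `x` after `d` steps would bring `-x` forward to step `k - d`.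
    apply hmin (k - d) (by omega)
    conv_lhs => rw [← hdx]
    rw [← mul_apply, ← pow_add, Nat.sub_add_cancel hdk.le, hkx]
  set l := (List.range k).map fun i => (w.1 ^ i) x with hl
  have hlen : l.length = k := by simp [hl]
  have hnd : (l.map Prod.fst).Nodup := by
    rw [hl, List.map_map]
    refine List.Nodup.map_on ?_ List.nodup_range
    intro i hi j hj hij
    rw [List.mem_range] at hi hj
    have aux : ∀ i j : ℕ, i < j → j < k → ((w.1 ^ i) x).1 ≠ ((w.1 ^ j) x).1 := by
      intro i j hij hj heq
      have h2 := hret (j - i) (by omega) (by omega)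
      have h3 : (w.1 ^ j) x = (w.1 ^ i) ((w.1 ^ (j - i)) x) := by
        rw [← mul_apply, ← pow_add, Nat.add_sub_cancel' hij.le]
      rcases fst_eq_iff.1 heq with h4 | h4
      · rw [h3] at h4
        exact h2.1 ((w.1 ^ i).injective h4).symm
      · rw [h3, ← hpowopp] at h4
        have := (w.1 ^ i).injective h4
        exact h2.2 (opp_eq_iff.1 this.symm)
    rcases lt_trichotomy i j with h1 | h1 | h1
    · exact absurd hij (aux i j h1 hj)
    · exact h1
    · exact absurd hij.symm (aux j i h1 hi)
  refine ⟨l, fun h0 => hk0 (by rw [← hlen, h0]; rfl), hnd, ?_⟩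
  have hL : l ++ l.map opp = (List.range (2 * k)).map fun i => (w.1 ^ i) x := by
    rw [two_mul, List.range_add, List.map_append, hl, List.map_map, List.map_map]
    congr 1
    refine List.map_congr_left fun i _ => ?_
    simp only [Function.comp]
    rw [add_comm, pow_add, mul_apply, hkx, hpowopp]
  have hnd' : (l ++ l.map opp).Nodup := nodup_append_map_opp hnd
  have hlen2 : (l ++ l.map opp).length = 2 * k := by
    rw [hL, List.length_map, List.length_range]
  have h2k : (w.1 ^ (2 * k)) x = x := by
    rw [two_mul, pow_add, mul_apply, hkx, hpowopp, hkx, opp_opp]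
  have hmodk : ∀ m, (w.1 ^ (m % (2 * k))) x = (w.1 ^ m) x := by
    intro m
    conv_rhs => rw [← Nat.mod_add_div m (2 * k), pow_add, pow_mul, mul_apply]
    have : ∀ j, ((w.1 ^ (2 * k)) ^ j) x = x := by
      intro j
      induction j with
      | zero => rfl
      | succ j ih => rw [pow_succ, mul_apply, h2k, ih]
    rw [this]
  have hform : ∀ m, balancedPerm l ((w.1 ^ m) x) = (w.1 ^ (m + 1)) x := by
    intro m
    rw [balancedPerm, ← hmodk m, ← hmodk (m + 1)]
    have hlt : m % (2 * k) < (l ++ l.map opp).length := by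
      rw [hlen2]
      exact Nat.mod_lt _ (by omega)
    have hget : ∀ i (hi : i < (l ++ l.map opp).length), (l ++ l.map opp)[i] = (w.1 ^ i) x := by
      intro i hi
      simp [hL]
    have h3 := List.formPerm_apply_getElem _ hnd' (m % (2 * k)) hlt
    rw [hget, hget] at h3
    rw [h3]
    congr 2
    rw [hlen2, Nat.mod_add_mod]
  ext1 y
  by_cases hy : w.1.SameCycle x y
  · obtain ⟨m, rfl⟩ := hy.exists_nat_pow_eq
    rw [hy.cycleOf_apply, hform, pow_succ', mul_apply]
  · rw [cycleOf_apply_of_not_sameCycle hy, balancedPerm, List.formPerm_apply_of_notMem]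
    rw [hL]
    intro hmem
    obtain ⟨i, -, rfl⟩ := List.mem_map.1 hmem
    exact hy ⟨i, by simp⟩

/-- `R` contains exactly one point of each balanced cycle of `w`. -/
structure IsBalReps (w : GroupB n) (R : Finset (SignedPoint n)) : Prop where
  bal : ∀ x ∈ R, Bal w x
  inj : ∀ x ∈ R, ∀ y ∈ R, w.1.SameCycle x y → x = y
  cover : ∀ x, Bal w x → ∃ r ∈ R, w.1.SameCycle r x

theorem exists_isBalReps (w : GroupB n) : ∃ R, IsBalReps w R := by
  classical
  let s := SameCycle.setoid w.1
  refine ⟨(Finset.univ.filter (Bal w)).image fun x => (Quotient.mk s x).out, ?_, ?_, ?_⟩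
  · intro x hx
    obtain ⟨y, hy, rfl⟩ := Finset.mem_image.1 hx
    exact (Finset.mem_filter.1 hy).2.of_sameCycle (Equiv.Perm.SameCycle.symm (Quotient.mk_out (s := s) y))
  · intro x hx y hy hxy
    obtain ⟨x, -, rfl⟩ := Finset.mem_image.1 hx
    obtain ⟨y, -, rfl⟩ := Finset.mem_image.1 hy
    have h1 : w.1.SameCycle (Quotient.mk s x).out x := Quotient.mk_out (s := s) x
    have h2 : w.1.SameCycle (Quotient.mk s y).out y := Quotient.mk_out (s := s) y
    have : Quotient.mk s x = Quotient.mk s y :=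
      Quotient.sound (h1.symm.trans (hxy.trans h2))
    simp only [this]
  · intro x hx
    exact ⟨_, Finset.mem_image_of_mem _ (by simpa using hx), Quotient.mk_out (s := s) x⟩

theorem IsBalReps.injOn {w : GroupB n} {R : Finset (SignedPoint n)} (h : IsBalReps w R) :
    Set.InjOn (fun x => w.1.cycleOf x) R := by
  intro x hx y hy hxy
  refine h.inj x hx y hy ?_
  have hsx := (mem_support.2 (h.bal x hx).apply_ne)
  have hsy := (mem_support.2 (h.bal y hy).apply_ne)
  exact (sameCycle_iff_cycleOf_eq_of_mem_support hsx hsy).2 hxy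

theorem balancedPartition_eq {w : GroupB n} {R : Finset (SignedPoint n)} (h : IsBalReps w R) :
    balancedPartition w = R.val.map fun x => rk (rep (balCycle w x)) := by
  classical
  have hinj : Set.InjOn (balCycle w) R := by
    intro x hx y hy hxy
    refine h.injOn hx hy ?_
    simp only [← balCycle_val (h.bal x hx), ← balCycle_val (h.bal y hy), hxy]
  have hset : (Finset.univ.filter fun c : GroupB n =>
      IsBalancedCycle (c : Equiv.Perm (SignedPoint n)) ∧
      (c : Equiv.Perm (SignedPoint n)) ∈ (w : Equiv.Perm (SignedPoint n)).cycleFactorsFinset)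
      = R.image (balCycle w) := by
    ext c
    simp only [Finset.mem_filter, Finset.mem_univ, true_and, Finset.mem_image]
    constructor
    · rintro ⟨h1, h2⟩
      obtain ⟨x, hx, hc⟩ := h1.exists_bal h2
      obtain ⟨r, hr, hrx⟩ := h.cover x hx
      refine ⟨r, hr, Subtype.ext ?_⟩
      rw [balCycle_val (h.bal r hr), hc, hrx.cycleOf_eq]
    · rintro ⟨r, hr, rfl⟩
      rw [balCycle_val (h.bal r hr)]
      exact ⟨(h.bal r hr).isBalancedCycle,
        cycleOf_mem_cycleFactorsFinset_iff.2 (mem_support.2 (h.bal r hr).apply_ne)⟩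
  rw [balancedPartition, hset, Finset.image_val_of_injOn hinj, Multiset.map_map]
  exact Multiset.map_congr rfl fun x _ => absLength_reflectionsB _

/-- The map `x ↦ -x` as a permutation. -/
def oppPerm (n : ℕ) : Equiv.Perm (SignedPoint n) := Function.Involutive.toPerm opp opp_opp

theorem oppPerm_apply (x : SignedPoint n) : oppPerm n x = x.opp := rfl

theorem oppPerm_inv_apply (x : SignedPoint n) : (oppPerm n)⁻¹ x = x.opp := rfl

theorem oppPerm_conj (w : GroupB n) : oppPerm n * w.1 * (oppPerm n)⁻¹ = w.1 := by
  ext1 x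
  rw [mul_apply, mul_apply, oppPerm_apply, oppPerm_inv_apply, GroupB.map_opp, opp_opp]

/-- Negation exchanges the two halves of each paired cycle, which have equal sign. A balanced cycle
has even support and therefore sign `-1`. -/
theorem sign_eq_neg_one_pow_card {w : GroupB n} {R : Finset (SignedPoint n)}
    (h : IsBalReps w R) : sign w.1 = (-1) ^ R.card := by
  classical
  have hprod : sign w.1 = ∏ c ∈ w.1.cycleFactorsFinset, sign c := by
    rw [sign_of_cycleType', cycleType_def, Multiset.map_map]
    refine congrArg Multiset.prod (Multiset.map_congr rfl fun c hc => ?_)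
    rw [(mem_cycleFactorsFinset_iff.1 (by simpa using hc)).1.sign]; rfl
  rw [hprod, ← Finset.prod_filter_mul_prod_filter_not _ (fun c => ∃ x, Bal w x ∧ c = w.1.cycleOf x)]
  have hset : (w.1.cycleFactorsFinset.filter fun c => ∃ x, Bal w x ∧ c = w.1.cycleOf x)
      = R.image fun x => w.1.cycleOf x := by
    ext c
    simp only [Finset.mem_filter, Finset.mem_image]
    constructor
    · rintro ⟨-, x, hx, rfl⟩
      obtain ⟨r, hr, hrx⟩ := h.cover x hx
      exact ⟨r, hr, hrx.cycleOf_eq⟩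
    · rintro ⟨r, hr, rfl⟩
      exact ⟨cycleOf_mem_cycleFactorsFinset_iff.2 (mem_support.2 (h.bal r hr).apply_ne),
        r, h.bal r hr, rfl⟩
  have h1 : ∏ c ∈ w.1.cycleFactorsFinset.filter (fun c => ∃ x, Bal w x ∧ c = w.1.cycleOf x),
      sign c = (-1) ^ R.card := by
    rw [← Finset.card_image_of_injOn h.injOn, ← hset]
    refine Finset.prod_eq_pow_card fun c hc => ?_
    obtain ⟨hc1, x, hx, rfl⟩ := Finset.mem_filter.1 hc
    have hcyc := isCycle_cycleOf w.1 hx.apply_ne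
    rw [hcyc.sign]
    -- Negation is a fixed-point-free involution of the support, so the factors `-1` cancel in
    -- pairs.
    have : (-1 : ℤˣ) ^ (w.1.cycleOf x).support.card = 1 := by
      rw [← Finset.prod_const]
      refine Finset.prod_involution (fun a _ => a.opp) (fun _ _ => by simp)
        (fun a _ _ => opp_ne a) (fun a ha => ?_) (fun a _ => opp_opp a)
      rw [mem_support_cycleOf_iff' hx.apply_ne] at ha ⊢
      exact Equiv.Perm.SameCycle.trans hx (sameCycle_opp ha)
    rw [this]
  have h2 : ∏ c ∈ w.1.cycleFactorsFinset.filter (fun c => ¬ ∃ x, Bal w x ∧ c = w.1.cycleOf x),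
      sign c = 1 := by
    have hinvol : ∀ c : Equiv.Perm (SignedPoint n),
        oppPerm n * (oppPerm n * c * (oppPerm n)⁻¹) * (oppPerm n)⁻¹ = c := by
      intro c
      ext1 x
      simp only [mul_apply, oppPerm_apply, oppPerm_inv_apply, opp_opp]
    have hmem : ∀ c ∈ w.1.cycleFactorsFinset,
        oppPerm n * c * (oppPerm n)⁻¹ ∈ w.1.cycleFactorsFinset := by
      intro c hc
      have := (mem_cycleFactorsFinset_conj w.1 (oppPerm n) c).2 hc
      rwa [oppPerm_conj] at this
    have hfix : ∀ c ∈ w.1.cycleFactorsFinset, ∀ x, c x ≠ x → c x.opp ≠ x.opp →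
        Bal w x ∧ c = w.1.cycleOf x := by
      intro c hc x hx hx'
      have he := cycle_is_cycleOf (mem_support.2 hx) hc
      refine ⟨?_, he⟩
      have := mem_support.2 hx'
      rw [he] at this
      exact (mem_support_cycleOf_iff.1 this).1
    refine Finset.prod_involution (fun c _ => oppPerm n * c * (oppPerm n)⁻¹) ?_ ?_ ?_ ?_
    · intro c _
      rw [map_mul, map_mul, sign_inv, mul_comm (sign (oppPerm n)), mul_assoc,
        Int.units_mul_self, mul_one, Int.units_mul_self]
    -- A cycle stable under conjugation by negation contains `-x` together with `x`, so it is
    -- balanced.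
    · intro c hc _ heq
      obtain ⟨hc1, hc2⟩ := Finset.mem_filter.1 hc
      obtain ⟨x, hx, -⟩ := (mem_cycleFactorsFinset_iff.1 hc1).1
      apply hc2
      refine ⟨x, hfix c hc1 x hx fun h3 => hx ?_⟩
      have h4 := congrArg (fun f => f x) heq
      simp only [mul_apply, oppPerm_apply, oppPerm_inv_apply, h3, opp_opp] at h4
      exact h4.symm
    · intro c hc
      obtain ⟨hc1, hc2⟩ := Finset.mem_filter.1 hc
      refine Finset.mem_filter.2 ⟨hmem c hc1, ?_⟩
      rintro ⟨x, hx, hxe⟩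
      apply hc2
      have h5 : c = w.1.cycleOf x := by
        rw [← hinvol c, hxe]
        ext1 y
        rw [mul_apply, mul_apply, oppPerm_apply, oppPerm_inv_apply, cycleOf_opp hx, opp_opp]
      exact ⟨x, hx, h5⟩
    · intro c _
      exact hinvol c
  rw [h1, h2, mul_one]

theorem balCycle_apply_of_sameCycle {w : GroupB n} {x y : SignedPoint n} (h : Bal w x)
    (hy : w.1.SameCycle x y) : (balCycle w x).1 y = w.1 y := by
  rw [balCycle_val h, hy.cycleOf_apply]

theorem balCycle_apply_of_not_sameCycle {w : GroupB n} {x y : SignedPoint n} (h : Bal w x)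
    (hy : ¬ w.1.SameCycle x y) : (balCycle w x).1 y = y := by
  rw [balCycle_val h, cycleOf_apply_of_not_sameCycle hy]

theorem bal_balCycle {w : GroupB n} {x : SignedPoint n} (h : Bal w x) : Bal (balCycle w x) x := by
  obtain ⟨k, hk⟩ := Equiv.Perm.SameCycle.exists_nat_pow_eq h
  refine ⟨k, ?_⟩
  rw [balCycle_val h, zpow_natCast, cycleOf_pow_apply_self, hk]

theorem one_le_rk_balCycle {w : GroupB n} {x : SignedPoint n} (h : Bal w x) :
    1 ≤ rk (rep (balCycle w x)) := by
  rw [Nat.one_le_iff_ne_zero, Ne, rk_eq_zero]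
  intro h1
  have h2 : balCycle w x = 1 := rep_injective (by rw [h1, map_one])
  have h3 := (bal_balCycle h).apply_ne
  rw [h2] at h3
  exact h3 rfl

/-- If `w x ≠ -x`, then `bv x` and `bv (w x)` are independent vectors in the moved space. If `w x =
-x`, the cycle is the reflection `[x]`. -/
theorem rk_balCycle_eq_one_iff {w : GroupB n} {x : SignedPoint n} (h : Bal w x) :
    rk (rep (balCycle w x)) = 1 ↔ w.1 x = x.opp := by
  constructor
  · intro h1
    by_contra hne
    have hx := bal_balCycle h
    have hx' : Bal (balCycle w x) (w.1 x) := by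
      rw [← balCycle_apply_of_sameCycle h (SameCycle.refl _ _)]
      exact hx.of_sameCycle ⟨1, by simp⟩
    obtain ⟨γ, -, hγ⟩ := finrank_eq_one_iff'.1 h1
    obtain ⟨a, ha⟩ := hγ ⟨_, bv_mem_mov_iff.2 hx⟩
    obtain ⟨b, hb⟩ := hγ ⟨_, bv_mem_mov_iff.2 hx'⟩
    have ha' : a • (γ : EuclideanSpace ℝ (Fin n)) = bv x := congrArg Subtype.val ha
    have hb' : b • (γ : EuclideanSpace ℝ (Fin n)) = bv (w.1 x) := congrArg Subtype.val hb
    have h0 : (w.1 x).1 ≠ x.1 := fun h2 =>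
      (fst_eq_iff.1 h2).elim h.apply_ne hne
    have e1 : a * co γ x = 1 := by rw [← co_smul, ha', co_bv_self]
    have e2 : a * co γ (w.1 x) = 0 := by rw [← co_smul, ha', co_bv_of_ne h0]
    have e3 : b * co γ (w.1 x) = 1 := by rw [← co_smul, hb', co_bv_self]
    rcases mul_eq_zero.1 e2 with h4 | h4
    · rw [h4, zero_mul] at e1; exact zero_ne_one e1
    · rw [h4, mul_zero] at e3; exact zero_ne_one e3
  · intro h1
    have hc : balCycle w x = reflB x x.opp := by
      ext1
      rw [reflB_eq_swap]
      ext1 y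
      by_cases hy : w.1.SameCycle x y
      · rw [balCycle_apply_of_sameCycle h hy]
        have : y = x ∨ y = x.opp := by
          obtain ⟨k, rfl⟩ := hy.exists_nat_pow_eq
          induction k with
          | zero => left; rfl
          | succ k ih =>
            rw [pow_succ', mul_apply]
            rcases ih ⟨k, by simp⟩ with h2 | h2
            · right; rw [h2, h1]
            · left; rw [h2, GroupB.map_opp, h1, opp_opp]
        rcases this with rfl | rfl
        · rw [h1, Equiv.swap_apply_left]
        · rw [GroupB.map_opp, h1, opp_opp, Equiv.swap_apply_right]
      · rw [balCycle_apply_of_not_sameCycle h hy, Equiv.swap_apply_of_ne_of_ne]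
        · rintro rfl; exact hy (SameCycle.refl _ _)
        · rintro rfl; exact hy h
    rw [hc]
    exact (isReflectionAlong_reflB (opp_ne x).symm).rk_eq

theorem rk_balCycle_lt {w : GroupB n} {x y : SignedPoint n} (h : Bal w x)
    (hy : ¬ w.1.SameCycle x y) : rk (rep (balCycle w x)) < n := by
  have hlt : mov (rep (balCycle w x)) < ⊤ := by
    refine lt_top_iff_ne_top.2 fun htop => ?_
    have h1 : bv y ∈ mov (rep (balCycle w x)) := htop ▸ Submodule.mem_top
    exact (bv_mem_mov_iff.1 h1).apply_ne (balCycle_apply_of_not_sameCycle h hy)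
  have := Submodule.finrank_lt hlt.ne
  rwa [finrank_euclideanSpace_fin] at this

end Cycles

/-! ### From lattices to joins of even elements. -/

section Lattice

/-- In a finite poset with a bottom element and binary joins every finite set has a join; the meet
of two elements is the join of their common lower bounds. -/
theorem exists_lattice_of_isLUB {α : Type*} [PartialOrder α] [Finite α] (hbot : ∃ b : α, ∀ a, b ≤ a)
    (h : ∀ a b : α, ∃ c, IsLUB {a, b} c) : ∃ L : Lattice α, ∀ a b : α, L.le a b ↔ a ≤ b := by
  classical
  have := Fintype.ofFinite α
  choose sup hsup using h
  have hfin : ∀ s : Finset α, ∃ c, IsLUB (s : Set α) c := by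
    intro s
    induction s using Finset.induction_on with
    | empty =>
      obtain ⟨b, hb⟩ := hbot
      exact ⟨b, by simp [IsLUB, IsLeast, lowerBounds, upperBounds, hb]⟩
    | insert a s _ ih =>
      obtain ⟨c, hc⟩ := ih
      refine ⟨sup a c, fun x hx => ?_, fun x hx => ?_⟩
      · rcases Finset.mem_insert.1 hx with rfl | hx
        · exact (hsup _ _).1 (by simp)
        · exact (hc.1 hx).trans ((hsup a c).1 (by simp))
      · refine (hsup a c).2 ?_
        rintro y (rfl | rfl)
        · exact hx (by simp)
        · exact hc.2 fun z hz => hx (by simp [Finset.mem_coe.1 hz])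
  choose S hS using hfin
  let inf : α → α → α := fun a b => S (Finset.univ.filter fun x => x ≤ a ∧ x ≤ b)
  refine ⟨{ sup := sup
            inf := inf
            le_sup_left := fun a b => (hsup a b).1 (by simp)
            le_sup_right := fun a b => (hsup a b).1 (by simp)
            sup_le := fun a b c hac hbc => (hsup a b).2 (by rintro y (rfl | rfl) <;> assumption)
            inf_le_left := fun a b => (hS _).2 fun x hx => by
              simp at hx; exact hx.1
            inf_le_right := fun a b => (hS _).2 fun x hx => by
              simp at hx; exact hx.2
            le_inf := fun a b c hab hac => (hS _).1 (by simp [hab, hac]) }, fun a b => Iff.rfl⟩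

theorem exists_join_of_lattice {α : Type*} {r : α → α → Prop}
    (h : ∃ L : Lattice α, ∀ a b : α, L.le a b ↔ r a b) (x y : α) :
    ∃ z, r x z ∧ r y z ∧ ∀ u, r x u → r y u → r z u := by
  obtain ⟨L, hL⟩ := h
  have hL' : ∀ a b : α, a ≤ b ↔ r a b := hL
  refine ⟨x ⊔ y, (hL' _ _).1 le_sup_left, (hL' _ _).1 le_sup_right, fun u hx hy => ?_⟩
  exact (hL' _ _).1 (sup_le ((hL' _ _).2 hx) ((hL' _ _).2 hy))

variable {n : ℕ}

open Equiv.Perm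

/-- The order on `B_n` given by the absolute order on isometries. -/
abbrev BLe (u w : GroupB n) : Prop := Below (rep u) (rep w)

/-- `x` and `y` have a join among the even elements below `w`. -/
def HasJoin (w x y : GroupB n) : Prop :=
  ∃ z : GroupB n, sign z.1 = 1 ∧ BLe z w ∧ BLe x z ∧ BLe y z ∧
    ∀ u : GroupB n, sign u.1 = 1 → BLe u w → BLe x u → BLe y u → BLe z u

theorem BLe.antisymm {u v : GroupB n} (h₁ : BLe u v) (h₂ : mov (rep v) ≤ mov (rep u)) : u = v :=
  rep_injective (Below.antisymm h₁ h₂)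

theorem mem_absInterval_iff {w x : GroupD n} :
    x ∈ absInterval (reflectionsD n) 1 w ↔ BLe x.1 w.1 := by
  rw [absInterval, Set.mem_ofPred_eq, absLE_reflectionsD_iff, absLE_reflectionsD_iff]
  simp [one_below]

theorem absIntervalIsLattice_iff (w : GroupD n) : AbsIntervalIsLattice (reflectionsD n) 1 w ↔
    ∀ x y : GroupB n, sign x.1 = 1 → sign y.1 = 1 → BLe x w.1 → BLe y w.1 → HasJoin w.1 x y := by
  constructor
  · intro h x y hx hy hxw hyw
    let lift : ∀ u : GroupB n, sign u.1 = 1 → BLe u w.1 → absInterval (reflectionsD n) 1 w :=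
      fun u hu huw => ⟨⟨u, mem_groupD_of_sign hu⟩, mem_absInterval_iff.2 huw⟩
    obtain ⟨z, hxz, hyz, hz⟩ := exists_join_of_lattice (α := absInterval (reflectionsD n) 1 w)
      (r := fun a b => AbsLE (reflectionsD n) (a : GroupD n) (b : GroupD n)) h
      (lift x hx hxw) (lift y hy hyw)
    have key : ∀ a b : absInterval (reflectionsD n) 1 w,
        AbsLE (reflectionsD n) a.1 b.1 ↔ BLe a.1.1 b.1.1 := fun a b => absLE_reflectionsD_iff
    refine ⟨z.1.1, sign_of_mem_groupD z.1.2, mem_absInterval_iff.1 z.2,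
      (key (lift x hx hxw) z).1 hxz, (key (lift y hy hyw) z).1 hyz, fun u hu huw hxu hyu => ?_⟩
    exact (key z (lift u hu huw)).1 (hz (lift u hu huw)
      ((key (lift x hx hxw) (lift u hu huw)).2 hxu) ((key (lift y hy hyw) (lift u hu huw)).2 hyu))
  · intro h
    let _ : PartialOrder (absInterval (reflectionsD n) 1 w) :=
      { le := fun a b => AbsLE (reflectionsD n) (a : GroupD n) (b : GroupD n)
        le_refl := fun a => absLE_reflectionsD_iff.2 (below_refl _)
        le_trans := fun a b c hab hbc => absLE_reflectionsD_iff.2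
          ((absLE_reflectionsD_iff.1 hab).trans (absLE_reflectionsD_iff.1 hbc))
        le_antisymm := fun a b hab hba => Subtype.ext (Subtype.ext
          (BLe.antisymm (absLE_reflectionsD_iff.1 hab) (absLE_reflectionsD_iff.1 hba).mov_le)) }
    have hle : ∀ a b : absInterval (reflectionsD n) 1 w, a ≤ b ↔ BLe a.1.1 b.1.1 :=
      fun a b => absLE_reflectionsD_iff
    refine exists_lattice_of_isLUB ?_ ?_
    · refine ⟨⟨1, mem_absInterval_iff.2 ?_⟩, fun a => (hle _ _).2 ?_⟩ <;>
        simp [BLe, one_below]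
    · intro a b
      obtain ⟨z, hz, hzw, haz, hbz, hmin⟩ := h a.1.1 b.1.1 (sign_of_mem_groupD a.1.2)
        (sign_of_mem_groupD b.1.2) (mem_absInterval_iff.1 a.2) (mem_absInterval_iff.1 b.2)
      refine ⟨⟨⟨z, mem_groupD_of_sign hz⟩, mem_absInterval_iff.2 hzw⟩, ?_, ?_⟩
      · rintro c (rfl | rfl)
        · exact (hle _ _).2 haz
        · exact (hle _ _).2 hbz
      · intro c hc
        exact (hle _ _).2 (hmin c.1.1 (sign_of_mem_groupD c.1.2) (mem_absInterval_iff.1 c.2)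
          ((hle _ _).1 (hc (by simp))) ((hle _ _).1 (hc (by simp))))

end Lattice

/-! ### Balanced restrictions and the two obstructions to joins. -/

section BalancedRestriction

variable {n : ℕ}

open Equiv.Perm

theorem mem_of_bv_mem {S : Submodule ℝ (EuclideanSpace ℝ (Fin n))} {I : Finset (Fin n)}
    (hS : ∀ i ∈ I, bv (i, 1) ∈ S) {ξ : EuclideanSpace ℝ (Fin n)} (hξ : ∀ i ∉ I, ξ i = 0) :
    ξ ∈ S := by
  have : ξ = ∑ i ∈ I, ξ i • bv (i, 1) := by
    ext j
    have hco : ∀ v : EuclideanSpace ℝ (Fin n), v j = co v (j, 1) := fun v => by simp [co]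
    rw [hco, hco, co_sum]
    simp only [co_smul]
    by_cases hj : j ∈ I
    · rw [Finset.sum_eq_single_of_mem j hj, co_bv_self, mul_one, ← hco]
      intro i _ hij
      rw [co_bv_of_ne (by exact hij.symm), mul_zero]
    · rw [← hco, hξ j hj, Finset.sum_eq_zero]
      intro i hi
      rw [co_bv_of_ne (by rintro rfl; exact hj hi), mul_zero]
  rw [this]
  exact sum_mem fun i hi => S.smul_mem _ (hS i hi)

theorem bal_fst {w : GroupB n} {x : SignedPoint n} : Bal w (x.1, 1) ↔ Bal w x := by
  rcases fst_eq_iff.1 (show x.1 = ((x.1, 1) : SignedPoint n).1 from rfl) with h | h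
  · rw [← h]
  · have : Bal w x ↔ Bal w (opp (x.1, 1)) := by rw [← h]
    rw [this, bal_opp]

/-- `u` is the restriction of `w` to the set `I` of indices of balanced points. -/
structure IsBalRestriction (w : GroupB n) (I : Finset (Fin n)) (u : GroupB n) : Prop where
  le : BLe u w
  mem_mov : ∀ ξ, ξ ∈ mov (rep u) ↔ ∀ i ∉ I, ξ i = 0

theorem exists_isBalRestriction {w : GroupB n} {I : Finset (Fin n)}
    (hI : ∀ i ∈ I, Bal w (i, 1)) : ∃ u, IsBalRestriction w I u := by
  obtain ⟨u, hu, hm⟩ := exists_restriction w I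
  refine ⟨u, hu, fun ξ => (hm ξ).trans ⟨fun h => h.2, fun h => ⟨?_, h⟩⟩⟩
  exact mem_of_bv_mem (fun i hi => bv_mem_mov_iff.2 (hI i hi)) h

namespace IsBalRestriction

variable {w u : GroupB n} {I : Finset (Fin n)} (h : IsBalRestriction w I u)
include h

theorem bal_iff {x : SignedPoint n} : Bal u x ↔ x.1 ∈ I := by
  rw [← bv_mem_mov_iff, h.mem_mov]
  have hco : ∀ v : EuclideanSpace ℝ (Fin n), ∀ j, v j = co v (j, 1) := fun v j => by simp [co]
  constructor
  · intro h1
    by_contra h2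
    have := h1 _ h2
    have h3 := co_bv_self x
    rw [co, this, mul_zero] at h3
    exact zero_ne_one h3
  · intro h1 i hi
    rw [hco, co_bv_of_ne]
    rintro rfl
    exact hi h1

theorem mov_le_iff {v : GroupB n} : mov (rep u) ≤ mov (rep v) ↔ ∀ i ∈ I, Bal v (i, 1) := by
  constructor
  · intro hle i hi
    exact bv_mem_mov_iff.1 (hle (bv_mem_mov_iff.2 (h.bal_iff.2 hi)))
  · intro hI ξ hξ
    exact mem_of_bv_mem (fun i hi => bv_mem_mov_iff.2 (hI i hi)) ((h.mem_mov ξ).1 hξ)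

theorem le_of_bal {v : GroupB n} (hv : BLe v w) (hI : ∀ i ∈ I, Bal v (i, 1)) : BLe u v :=
  below_of_mov_le h.le hv (h.mov_le_iff.2 hI)

theorem refl_le {a b : SignedPoint n} (hab : a ≠ b) (ha : a.1 ∈ I) (hb : b.1 ∈ I) :
    BLe (reflB a b) u :=
  (isReflectionAlong_reflB hab).below_iff.2
    (sub_mem (bv_mem_mov_iff.2 (h.bal_iff.2 ha)) (bv_mem_mov_iff.2 (h.bal_iff.2 hb)))

/-- The balanced cycles of `u` are the traces on `I` of those of `w`, by `bal_form_eq`, so the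
parity counts the cycles of `w` that meet `I`. -/
theorem sign_eq {R : Finset (SignedPoint n)} (hR : ∀ x ∈ R, x.1 ∈ I)
    (hinj : ∀ x ∈ R, ∀ y ∈ R, w.1.SameCycle x y → x = y)
    (hcov : ∀ x : SignedPoint n, x.1 ∈ I → ∃ r ∈ R, w.1.SameCycle r x) :
    sign u.1 = (-1) ^ R.card := by
  apply sign_eq_neg_one_pow_card
  refine ⟨fun x hx => h.bal_iff.2 (hR x hx), fun x hx y hy hxy => ?_, fun x hx => ?_⟩
  · exact hinj x hx y hy ((bal_form_eq h.le (h.bal_iff.2 (hR x hx))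
      (h.bal_iff.2 (hR y hy))).1 hxy)
  · obtain ⟨r, hr, hrx⟩ := hcov x (h.bal_iff.1 hx)
    exact ⟨r, hr, (bal_form_eq h.le (h.bal_iff.2 (hR r hr)) hx).2 hrx⟩

end IsBalRestriction

/-- Two elements whose upper bounds `p`, `q` meet in an odd element spanned by them have no join. -/
theorem not_hasJoin {w x y p q β : GroupB n} (hp : sign p.1 = 1) (hq : sign q.1 = 1)
    (hβ : sign β.1 ≠ 1) (hpw : BLe p w) (hqw : BLe q w) (hβp : BLe β p)
    (hxp : BLe x p) (hyp : BLe y p) (hxq : BLe x q) (hyq : BLe y q)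
    (hinf : mov (rep p) ⊓ mov (rep q) ≤ mov (rep β))
    (hsup : mov (rep β) ≤ mov (rep x) ⊔ mov (rep y)) : ¬ HasJoin w x y := by
  rintro ⟨z, hz, -, hxz, hyz, hmin⟩
  have hzp := hmin p hp hpw hxp hyp
  have hzq := hmin q hq hqw hxq hyq
  have h1 : mov (rep z) ≤ mov (rep β) := (le_inf hzp.mov_le hzq.mov_le).trans hinf
  have h2 : mov (rep β) ≤ mov (rep z) := hsup.trans (sup_le hxz.mov_le hyz.mov_le)
  have h3 : BLe β z := below_of_mov_le hβp hzp h2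
  exact hβ (BLe.antisymm h3 h1 ▸ hz)

theorem exists_fst_sameCycle {w : GroupB n} {R : Finset (SignedPoint n)}
    (hbal : ∀ x ∈ R, Bal w x) {x : SignedPoint n} (hx : ∃ r ∈ R, x.1 = r.1) :
    ∃ r ∈ R, w.1.SameCycle r x := by
  obtain ⟨r, hr, h⟩ := hx
  rcases fst_eq_iff.1 h with rfl | rfl
  · exact ⟨x, hr, SameCycle.refl _ _⟩
  · exact ⟨r, hr, hbal r hr⟩

/-- With `b = w a`, the reflections `((a, b))` and `((a, -b))` span the plane of the coordinates
`a`, `b`. The restriction `β` of `w` to it is a single balanced cycle, hence odd; adding `c` or `d`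
adds one cycle and gives the even upper bounds `p` and `q`. Only the indices of `c` and `d` must
differ: they may share a cycle. -/
theorem exists_not_hasJoin_of_long {w : GroupB n} {a c d : SignedPoint n} (ha : Bal w a)
    (hlong : w.1 a ≠ a.opp) (hc : Bal w c) (hd : Bal w d) (hac : ¬ w.1.SameCycle a c)
    (had : ¬ w.1.SameCycle a d) (hcd : c.1 ≠ d.1) :
    ∃ x y : GroupB n, sign x.1 = 1 ∧ sign y.1 = 1 ∧ BLe x w ∧ BLe y w ∧ ¬ HasJoin w x y := by
  classical
  set b := w.1 a with hb
  have hsab : w.1.SameCycle a b := ⟨1, by simp [hb]⟩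
  have hbb : Bal w b := ha.of_sameCycle hsab
  have hab : a.1 ≠ b.1 := by
    intro h
    rcases fst_eq_iff.1 h.symm with h1 | h1
    · exact ha.apply_ne h1
    · exact hlong h1
  have hne : a ≠ b := fun h => hab (h ▸ rfl)
  have hne' : a ≠ b.opp := fun h => hab (h ▸ rfl)
  have hfst : ∀ x, ¬ w.1.SameCycle a x → a.1 ≠ x.1 ∧ b.1 ≠ x.1 := by
    intro x hx
    constructor
    · intro h
      rcases fst_eq_iff.1 h with rfl | h1
      · exact hx (SameCycle.refl _ _)
      · rw [← opp_eq_iff] at h1; exact hx (h1 ▸ ha)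
    · intro h
      rcases fst_eq_iff.1 h with h1 | h1
      · exact hx (h1 ▸ hsab)
      · rw [← opp_eq_iff] at h1; exact hx (h1 ▸ hsab.trans hbb)
  have hpair : ∀ x, Bal w x → ¬ w.1.SameCycle a x →
      ∃ p, IsBalRestriction w {a.1, b.1, x.1} p ∧ sign p.1 = 1 := by
    intro x hx hax
    obtain ⟨p, hp⟩ := exists_isBalRestriction (w := w) (I := {a.1, b.1, x.1}) (by
      intro i hi
      simp only [Finset.mem_insert, Finset.mem_singleton] at hi
      rcases hi with rfl | rfl | rfl
      · exact bal_fst.2 ha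
      · exact bal_fst.2 hbb
      · exact bal_fst.2 hx)
    refine ⟨p, hp, ?_⟩
    have hne : a ≠ x := fun h => hax (h ▸ SameCycle.refl _ _)
    rw [hp.sign_eq (R := {a, x}), Finset.card_pair hne]
    · rfl
    · intro y hy
      simp only [Finset.mem_insert, Finset.mem_singleton] at hy ⊢
      rcases hy with rfl | rfl <;> simp
    · intro y hy z hz hyz
      simp only [Finset.mem_insert, Finset.mem_singleton] at hy hz
      rcases hy with rfl | rfl <;> rcases hz with rfl | rfl
      · rfl
      · exact absurd hyz hax
      · exact absurd hyz.symm hax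
      · rfl
    · intro y hy
      simp only [Finset.mem_insert, Finset.mem_singleton] at hy
      rcases hy with h | h | h
      · exact exists_fst_sameCycle (by simp [ha, hx]) ⟨a, by simp, h⟩
      · refine ⟨a, by simp, ?_⟩
        rcases fst_eq_iff.1 h with rfl | rfl
        · exact hsab
        · exact hsab.trans hbb
      · exact exists_fst_sameCycle (by simp [ha, hx]) ⟨x, by simp, h⟩
  obtain ⟨p, hp, hps⟩ := hpair c hc hac
  obtain ⟨q, hq, hqs⟩ := hpair d hd had
  obtain ⟨β, hβ⟩ := exists_isBalRestriction (w := w) (I := {a.1, b.1}) (by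
    intro i hi
    simp only [Finset.mem_insert, Finset.mem_singleton] at hi
    rcases hi with rfl | rfl
    · exact bal_fst.2 ha
    · exact bal_fst.2 hbb)
  have hβs : sign β.1 ≠ 1 := by
    rw [hβ.sign_eq (R := {a}), Finset.card_singleton]
    · decide
    · simp
    · simp
    · intro y hy
      simp only [Finset.mem_insert, Finset.mem_singleton] at hy
      refine ⟨a, by simp, ?_⟩
      rcases hy with h | h
      · rcases fst_eq_iff.1 h with rfl | rfl
        · exact SameCycle.refl _ _
        · exact ha
      · rcases fst_eq_iff.1 h with rfl | rfl
        · exact hsab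
        · exact hsab.trans hbb
  have hβp : BLe β p := hβ.le_of_bal hp.le (by
    intro i hi
    rw [hp.bal_iff]
    simp only [Finset.mem_insert, Finset.mem_singleton] at hi ⊢
    tauto)
  have hxp := hp.refl_le hne (by simp) (by simp)
  have hyp := hp.refl_le hne' (by simp) (by simp)
  refine ⟨reflB a b, reflB a b.opp, sign_reflB hab, sign_reflB hab, hxp.trans hp.le,
    hyp.trans hp.le, not_hasJoin hps hqs hβs hp.le hq.le hβp hxp hyp
      (hq.refl_le hne (by simp) (by simp)) (hq.refl_le hne' (by simp) (by simp)) ?_ ?_⟩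
  · rintro ξ ⟨h1, h2⟩
    rw [hβ.mem_mov]
    intro i hi
    have h1 := (hp.mem_mov ξ).1 h1 i
    have h2 := (hq.mem_mov ξ).1 h2 i
    simp only [Finset.mem_insert, Finset.mem_singleton, not_or] at hi h1 h2
    by_cases hic : i = c.1
    · exact h2 ⟨hi.1, hi.2, fun h => hcd (hic.symm.trans h)⟩
    · exact h1 ⟨hi.1, hi.2, hic⟩
  · intro ξ hξ
    rw [(isReflectionAlong_reflB hne).mov_eq, (isReflectionAlong_reflB hne').mov_eq]
    set S := Submodule.span ℝ {bv a - bv b} ⊔ Submodule.span ℝ {bv a - bv b.opp} with hS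
    have h1 : bv a - bv b ∈ S := Submodule.mem_sup_left (Submodule.mem_span_singleton_self _)
    have h2 : bv a - bv b.opp ∈ S := Submodule.mem_sup_right (Submodule.mem_span_singleton_self _)
    rw [bv_opp] at h2
    have hfst' : ∀ x : SignedPoint n, bv x ∈ S → bv (x.1, 1) ∈ S := by
      intro x hx
      rcases fst_eq_iff.1 (show x.1 = ((x.1, 1) : SignedPoint n).1 from rfl) with h | h
      · rwa [← h]
      · rw [h, bv_opp] at hx
        simpa using neg_mem hx
    refine mem_of_bv_mem (I := {a.1, b.1}) ?_ ((hβ.mem_mov ξ).1 hξ)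
    intro i hi
    simp only [Finset.mem_insert, Finset.mem_singleton] at hi
    rcases hi with rfl | rfl
    · apply hfst'
      -- Half the sum of the two roots is `bv a`; half their difference gives `bv b`.
      have := S.smul_mem (1 / 2 : ℝ) (add_mem h1 h2)
      convert this using 1
      module
    · apply hfst'
      have := S.smul_mem (-1 / 2 : ℝ) (sub_mem h1 h2)
      convert this using 1
      module

/-- Restrict `w` to points of different balanced cycles: `{a, b}` and `{a, c}` are even and span the
odd `{a, b, c}`, which is the intersection of the even `{a, b, c, d}` and `{a, b, c, e}`. -/
theorem exists_not_hasJoin_of_five {w : GroupB n} {R : Finset (SignedPoint n)}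
    (hbal : ∀ x ∈ R, Bal w x) (hinj : ∀ x ∈ R, ∀ y ∈ R, w.1.SameCycle x y → x = y)
    (hR : 5 ≤ R.card) :
    ∃ x y : GroupB n, sign x.1 = 1 ∧ sign y.1 = 1 ∧ BLe x w ∧ BLe y w ∧ ¬ HasJoin w x y := by
  classical
  obtain ⟨R', hsub, hcard⟩ := Finset.exists_subset_card_eq hR
  have hfst : Set.InjOn (Prod.fst : SignedPoint n → Fin n) R := by
    intro x hx y hy hxy
    refine hinj x hx y hy ?_
    rcases fst_eq_iff.1 hxy with rfl | rfl
    · exact SameCycle.refl _ _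
    · exact SameCycle.symm (hbal y hy)
  have hrest : ∀ Q ⊆ R, ∃ u, IsBalRestriction w (Q.image Prod.fst) u ∧
      sign u.1 = (-1) ^ Q.card := by
    intro Q hQ
    obtain ⟨u, hu⟩ := exists_isBalRestriction (w := w) (I := Q.image Prod.fst) (by
      intro i hi
      obtain ⟨x, hx, rfl⟩ := Finset.mem_image.1 hi
      exact bal_fst.2 (hbal x (hQ hx)))
    refine ⟨u, hu, hu.sign_eq (fun x hx => Finset.mem_image_of_mem _ hx)
      (fun x hx y hy => hinj x (hQ hx) y (hQ hy)) fun x hx => ?_⟩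
    obtain ⟨r, hr, h⟩ := Finset.mem_image.1 hx
    exact exists_fst_sameCycle (fun x hx => hbal x (hQ hx)) ⟨r, hr, h.symm⟩
  have hle : ∀ {Q Q' : Finset (SignedPoint n)} {u v : GroupB n}, Q ⊆ Q' →
      IsBalRestriction w (Q.image Prod.fst) u → IsBalRestriction w (Q'.image Prod.fst) v →
      BLe u v := by
    intro Q Q' u v hQ hu hv
    exact hu.le_of_bal hv.le fun i hi => hv.bal_iff.2 (Finset.image_subset_image hQ hi)
  obtain ⟨a, T, haT, rfl, hT⟩ := Finset.card_eq_succ.1 hcard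
  obtain ⟨b, c, d, e, hbc, hbd, hbe, hcd, hce, hde, rfl⟩ := Finset.card_eq_four.1 hT
  simp only [Finset.mem_insert, Finset.mem_singleton, not_or] at haT
  obtain ⟨hab, hac, had, hae⟩ := haT
  simp only [Finset.insert_subset_iff, Finset.singleton_subset_iff] at hsub
  obtain ⟨ha, hb, hc, hd, he⟩ := hsub
  obtain ⟨x, hx, hxs⟩ := hrest {a, b} (by simp [Finset.insert_subset_iff, ha, hb])
  obtain ⟨y, hy, hys⟩ := hrest {a, c} (by simp [Finset.insert_subset_iff, ha, hc])
  obtain ⟨β, hβ, hβs⟩ := hrest {a, b, c} (by simp [Finset.insert_subset_iff, ha, hb, hc])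
  obtain ⟨p, hp, hps⟩ := hrest {a, b, c, d} (by simp [Finset.insert_subset_iff, ha, hb, hc, hd])
  obtain ⟨q, hq, hqs⟩ := hrest {a, b, c, e} (by simp [Finset.insert_subset_iff, ha, hb, hc, he])
  rw [Finset.card_pair hab] at hxs
  rw [Finset.card_pair hac] at hys
  rw [Finset.card_eq_three.2 ⟨a, b, c, hab, hac, hbc, rfl⟩] at hβs
  rw [Finset.card_eq_four.2 ⟨a, b, c, d, hab, hac, had, hbc, hbd, hcd, rfl⟩] at hps
  rw [Finset.card_eq_four.2 ⟨a, b, c, e, hab, hac, hae, hbc, hbe, hce, rfl⟩] at hqs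
  have hxp : BLe x p := hle (by simp [Finset.insert_subset_iff]) hx hp
  have hyp : BLe y p := hle (by simp [Finset.insert_subset_iff]) hy hp
  have hxq : BLe x q := hle (by simp [Finset.insert_subset_iff]) hx hq
  have hyq : BLe y q := hle (by simp [Finset.insert_subset_iff]) hy hq
  have hβp : BLe β p := hle (by simp [Finset.insert_subset_iff]) hβ hp
  refine ⟨x, y, hxs, hys, hxp.trans hp.le, hyp.trans hp.le, not_hasJoin hps hqs ?_ hp.le hq.le hβp
    hxp hyp hxq hyq ?_ ?_⟩
  · rw [hβs]; decide
  · rintro ξ ⟨h1, h2⟩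
    rw [hβ.mem_mov]
    intro i hi
    have h1 := (hp.mem_mov ξ).1 h1 i
    have h2 := (hq.mem_mov ξ).1 h2 i
    simp only [Finset.mem_image, Finset.mem_insert, Finset.mem_singleton, exists_eq_or_imp,
      exists_eq_left, not_or] at hi h1 h2
    by_cases hid : d.1 = i
    · refine h2 ⟨hi.1, hi.2.1, hi.2.2, fun h => hde ?_⟩
      exact hfst hd he (hid.trans h.symm)
    · exact h1 ⟨hi.1, hi.2.1, hi.2.2, hid⟩
  · intro ξ hξ
    refine mem_of_bv_mem ?_ ((hβ.mem_mov ξ).1 hξ)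
    intro i hi
    simp only [Finset.mem_image, Finset.mem_insert, Finset.mem_singleton, exists_eq_or_imp,
      exists_eq_left] at hi
    rcases hi with rfl | rfl | rfl
    · exact Submodule.mem_sup_left (bv_mem_mov_iff.2 (hx.bal_iff.2 (by simp)))
    · exact Submodule.mem_sup_left (bv_mem_mov_iff.2 (hx.bal_iff.2 (by simp)))
    · exact Submodule.mem_sup_right (bv_mem_mov_iff.2 (hy.bal_iff.2 (by simp)))

end BalancedRestriction

/-! ### Reduction to joins of reflections; crossing roots. -/

section AtomJoins

variable {n : ℕ}

open Equiv.Perm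

theorem Below.of_inv_mul_below {V : Type*} [NormedAddCommGroup V] [InnerProductSpace ℝ V]
    {s x v : V ≃ₗᵢ[ℝ] V} (hx : Below s x) (hv : Below s v) (h : Below (s⁻¹ * x) (s⁻¹ * v)) :
    Below x v := by
  unfold Below at *
  rw [show (s⁻¹ * x)⁻¹ * (s⁻¹ * v) = x⁻¹ * v by group] at h
  omega

theorem HasJoin.symm {w x y : GroupB n} (h : HasJoin w x y) : HasJoin w y x := by
  obtain ⟨z, h1, h2, h3, h4, h5⟩ := h
  exact ⟨z, h1, h2, h4, h3, fun u hu huw hy hx => h5 u hu huw hx hy⟩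

theorem hasJoin_of_le {w x y : GroupB n} (hy : sign y.1 = 1) (hyw : BLe y w) (h : BLe x y) :
    HasJoin w x y :=
  ⟨y, hy, hyw, h, below_refl _, fun _ _ _ _ h => h⟩

theorem BLe.inv_mul_inv_mul {u v w : GroupB n} (h₁ : BLe u v) (h₂ : BLe v w) :
    BLe (u⁻¹ * v) (u⁻¹ * w) := by
  have := Below.inv_mul_inv_mul h₁ h₂
  simpa only [BLe, map_mul, map_inv] using this

theorem BLe.of_inv_mul {u v w : GroupB n} (hu : BLe u w) (h : BLe v (u⁻¹ * w)) :
    BLe (u * v) w ∧ BLe u (u * v) := by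
  have := Below.of_inv_mul (u := rep u) (v := rep v) (w := rep w) hu
    (by simpa only [BLe, map_mul, map_inv] using h)
  simpa only [BLe, map_mul, map_inv] using this

theorem BLe.inv_mul_le {u w : GroupB n} (h : BLe u w) : BLe (u⁻¹ * w) w := by
  have := Below.inv_mul_below h
  simpa only [BLe, map_mul, map_inv] using this

theorem BLe.of_inv_mul_le {s x v : GroupB n} (hx : BLe s x) (hv : BLe s v)
    (h : BLe (s⁻¹ * x) (s⁻¹ * v)) : BLe x v :=
  Below.of_inv_mul_below hx hv (by simpa only [BLe, map_mul, map_inv] using h)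

theorem sign_inv_mul {s x : GroupB n} (hs : sign s.1 = 1) (hx : sign x.1 = 1) :
    sign (s⁻¹ * x).1 = 1 := by
  rw [Subgroup.coe_mul, Subgroup.coe_inv, map_mul, sign_inv, hs, hx, one_mul]

/-- Left multiplication by `s⁻¹` carries the interval from `s` to `w` into the one from `1` to `s⁻¹
* w`, preserving order and evenness. -/
theorem hasJoin_of_inv_mul {s w x y : GroupB n} (hs : sign s.1 = 1) (hsx : BLe s x)
    (hsy : BLe s y) (hsw : BLe s w) (h : HasJoin (s⁻¹ * w) (s⁻¹ * x) (s⁻¹ * y)) :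
    HasJoin w x y := by
  obtain ⟨z, hz, hzw, hxz, hyz, hmin⟩ := h
  obtain ⟨h1, h2⟩ := hsw.of_inv_mul hzw
  have e : s⁻¹ * (s * z) = z := by group
  refine ⟨s * z, ?_, h1, hsx.of_inv_mul_le h2 (by rwa [e]), hsy.of_inv_mul_le h2 (by rwa [e]), ?_⟩
  · rw [Subgroup.coe_mul, map_mul, hs, hz, one_mul]
  · intro u hu huw hxu hyu
    have hsu : BLe s u := Below.trans hsx hxu
    refine h2.of_inv_mul_le hsu ?_
    rw [e]
    exact hmin _ (sign_inv_mul hs hu) (hsu.inv_mul_inv_mul huw) (hsx.inv_mul_inv_mul hxu)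
      (hsy.inv_mul_inv_mul hyu)

theorem exists_reflB_le {x : GroupB n} (hx : x ≠ 1) (hs : sign x.1 = 1) :
    ∃ a b : SignedPoint n, a.1 ≠ b.1 ∧ BLe (reflB a b) x := by
  obtain ⟨a, b, hab, h⟩ := exists_paired_root hx hs
  exact ⟨a, b, hab, (isReflectionAlong_reflB fun h' : a = b => hab (h' ▸ rfl)).below_iff.2 h⟩

/-- In a lower closed class of elements, joins of pairs of reflections suffice. -/
theorem hasJoin_of_atoms {P : GroupB n → Prop}
    (hdown : ∀ w v, P w → sign v.1 = 1 → BLe v w → P v) (hsign : ∀ w, P w → sign w.1 = 1)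
    (hatoms : ∀ w, P w → ∀ a b c d : SignedPoint n, a.1 ≠ c.1 → b.1 ≠ d.1 →
      BLe (reflB a c) w → BLe (reflB b d) w → HasJoin w (reflB a c) (reflB b d))
    {w : GroupB n} (hw : P w) {x y : GroupB n} (hx : sign x.1 = 1) (hy : sign y.1 = 1)
    (hxw : BLe x w) (hyw : BLe y w) : HasJoin w x y := by
  induction hk : rk (rep w) using Nat.strong_induction_on generalizing w x y with
  | _ k ih =>
    by_cases hx1 : x = 1
    · subst hx1
      exact hasJoin_of_le hy hyw (by simp [BLe, one_below])
    by_cases hy1 : y = 1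
    · subst hy1
      exact (hasJoin_of_le hx hxw (by simp [BLe, one_below])).symm
    -- Two elements above a common reflection are joined by induction, since dividing by the
    -- reflection lowers the rank of `w` and stays in `P`.
    have step : ∀ a c : SignedPoint n, a.1 ≠ c.1 → ∀ x y : GroupB n, sign x.1 = 1 →
        sign y.1 = 1 → BLe x w → BLe y w → BLe (reflB a c) x → BLe (reflB a c) y →
        HasJoin w x y := by
      intro a c hac x y hx hy hxw hyw hsx hsy
      have hsw : BLe (reflB a c) w := Below.trans hsx hxw
      have hs := sign_reflB hac
      refine hasJoin_of_inv_mul hs hsx hsy hsw (ih _ ?_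
        (hdown _ _ hw (sign_inv_mul hs (hsign w hw)) hsw.inv_mul_le) (sign_inv_mul hs hx)
        (sign_inv_mul hs hy) (hsx.inv_mul_inv_mul hxw) (hsy.inv_mul_inv_mul hyw) rfl)
      have h1 := (isReflectionAlong_reflB (fun h' : a = c => hac (h' ▸ rfl))).rk_eq
      have h2 : rk (rep (reflB a c)) + rk ((rep (reflB a c))⁻¹ * rep w) = rk (rep w) := hsw
      rw [← map_inv, ← map_mul] at h2
      omega
    obtain ⟨a, c, hac, hsx⟩ := exists_reflB_le hx1 hx
    obtain ⟨b, d, hbd, hty⟩ := exists_reflB_le hy1 hy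
    -- Take the join `z` of reflections `s ≤ x` and `t ≤ y`, then join `x` with `z` over `s`, and
    -- `y` with the result over `t`.
    obtain ⟨z, hz, hzw, hsz, htz, hzmin⟩ := hatoms w hw a b c d hac hbd (Below.trans hsx hxw)
      (Below.trans hty hyw)
    obtain ⟨p, hp, hpw, hxp, hzp, hpmin⟩ := step a c hac x z hx hz hxw hzw hsx hsz
    obtain ⟨q, hq, hqw, hyq, hpq, hqmin⟩ := step b d hbd y p hy hp hyw hpw hty
      (Below.trans htz hzp)
    refine ⟨q, hq, hqw, Below.trans hxp hpq, hyq, fun u hu huw hxu hyu => ?_⟩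
    exact hqmin u hu huw hyu (hpmin u hu huw hxu
      (hzmin u hu huw (Below.trans hsx hxu) (Below.trans hty hyu)))

/-- The roots `bv a - bv c` and `bv b - bv d` are not orthogonal for the form of `w`. -/
def NonOrtho (w : GroupB n) (a c b d : SignedPoint n) : Prop :=
  ∀ y, rep w y - y = bv b - bv d → co y a ≠ co y c

theorem NonOrtho.of_le {u w : GroupB n} {a c b d : SignedPoint n} (h : NonOrtho w a c b d)
    (hu : BLe u w) (hα : bv a - bv c ∈ mov (rep u)) (hβ : bv b - bv d ∈ mov (rep u)) :
    NonOrtho u a c b d := by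
  intro y hy heq
  obtain ⟨y', hy'⟩ := mem_mov.1 (hu.mov_le hβ)
  have := hu.inner_preimage_eq hy' hy hα
  rw [inner_sub_right, inner_sub_right, inner_bv, inner_bv, inner_bv, inner_bv, heq, sub_self,
    sub_eq_zero] at this
  exact h y' hy' this

theorem NonOrtho.opp {w : GroupB n} {a c b d : SignedPoint n} (h : NonOrtho w a c b d) :
    NonOrtho w a c b.opp d.opp := by
  intro y hy heq
  refine h (-y) ?_ (by rw [co_neg, co_neg, heq])
  rw [bv_opp, bv_opp] at hy
  rw [map_neg, ← neg_inj, ← sub_eq_zero]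
  rw [← sub_eq_zero] at hy
  rw [← hy]; abel

theorem NonOrtho.opp_left {w : GroupB n} {a c b d : SignedPoint n} (h : NonOrtho w a c b d) :
    NonOrtho w a.opp c.opp b d := by
  intro y hy heq
  rw [co_opp, co_opp, neg_inj] at heq
  exact h y hy heq

theorem hasJoin_of_not_nonOrtho {w : GroupB n} {a c b d : SignedPoint n} (hac : a.1 ≠ c.1)
    (hbd : b.1 ≠ d.1) (hα : BLe (reflB a c) w) (h : ¬ NonOrtho w a c b d) :
    HasJoin w (reflB a c) (reflB b d) := by
  unfold NonOrtho at h
  push Not at h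
  obtain ⟨y, hy, h0⟩ := h
  have hs := isReflectionAlong_reflB (fun h' : a = c => hac (h' ▸ rfl))
  have ht := isReflectionAlong_reflB (fun h' : b = d => hbd (h' ▸ rfl))
  have h1 := hs.mul_below ht (hs.below_iff.1 hα) hy
    (by rw [inner_sub_right, inner_bv, inner_bv, h0, sub_self])
  have h2 := hs.mul_isJoin ht h1.2 h1.1
  rw [← map_mul] at h1 h2
  refine ⟨reflB b d * reflB a c, ?_, h1.1, h2.1, h2.2.1, fun u _ huw h3 h4 => h2.2.2 _ huw h3 h4⟩
  rw [Subgroup.coe_mul, map_mul, sign_reflB hac, sign_reflB hbd, one_mul]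

theorem bal_iff_of_mem_mov {u : GroupB n} {a c : SignedPoint n}
    (h : bv a - bv c ∈ mov (rep u)) : Bal u a ↔ Bal u c := by
  rcases bv_sub_mem_mov_iff.1 h with h1 | ⟨h1, h2⟩
  · exact ⟨fun h => h.of_sameCycle h1, fun h => h.of_sameCycle h1.symm⟩
  · exact ⟨fun _ => h2, fun _ => h1⟩

theorem sameCycle_of_mem_mov {u : GroupB n} {a c : SignedPoint n}
    (h : bv a - bv c ∈ mov (rep u)) (ha : ¬ Bal u a) : u.1.SameCycle a c :=
  (bv_sub_mem_mov_iff.1 h).resolve_right fun h => ha h.1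

/-- For non-balanced `b` the root `bv b - bv d` has a preimage supported on the cycles of `±b`. If
`a` lay elsewhere, so would `c` up to sign, and both coordinates would vanish. -/
theorem NonOrtho.sameCycle {u : GroupB n} {a c b d : SignedPoint n} (h : NonOrtho u a c b d)
    (hα : bv a - bv c ∈ mov (rep u)) (hβ : bv b - bv d ∈ mov (rep u)) (hb : ¬ Bal u b) :
    u.1.SameCycle a b ∨ u.1.SameCycle a b.opp := by
  have hs := (sameCycle_of_mem_mov hβ hb).symm
  obtain ⟨g, hg, h0⟩ := exists_segment hs
  by_contra! hcon
  have key : ∀ x, u.1.SameCycle a x ∨ Bal u x → co g x = 0 := by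
    intro x hx
    refine h0 x (fun h1 => ?_) (fun h1 => ?_)
    · rcases hx with hx | hx
      · exact hcon.1 (hx.trans (h1.symm.trans hs))
      · exact hb (hx.of_sameCycle (h1.symm.trans hs))
    · rcases hx with hx | hx
      · have := sameCycle_opp (h1.symm.trans hs)
        rw [opp_opp] at this
        exact hcon.2 (hx.trans this)
      · exact hb ((bal_opp.2 hx).of_sameCycle (h1.symm.trans hs))
  refine h g hg ?_
  rcases bv_sub_mem_mov_iff.1 hα with h1 | ⟨h1, h2⟩
  · rw [key a (Or.inl (SameCycle.refl _ _)), key c (Or.inl h1)]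
  · rw [key a (Or.inr h1), key c (Or.inr h2)]

/-- The values of a preimage of `bv a - bv c` on the paired cycle of a smaller element. -/
theorem NonOrtho.preimage_values {u w : GroupB n} {a c b d : SignedPoint n} (hu : BLe u w)
    (h : NonOrtho u b d a c) (hac : a ≠ c) (ha : ¬ Bal u a) (hsc : u.1.SameCycle a c)
    (hsb : u.1.SameCycle a b) (hsd : u.1.SameCycle a d) {y : EuclideanSpace ℝ (Fin n)}
    (hy : rep w y - y = bv a - bv c) :
    co y c = co y a + 1 ∧
      ((co y b = co y a ∧ co y d = co y c) ∨ (co y b = co y c ∧ co y d = co y a)) := by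
  obtain ⟨g, hg⟩ := mem_mov.1 (bv_sub_mem_mov_iff.2 (Or.inl hsc))
  -- Only differences can be compared between `w` and `u`: `bv a` itself need not lie in `mov (rep
  -- u)`.
  have tr : ∀ x, u.1.SameCycle a x → co y a - co y x = co g a - co g x := by
    intro x hx
    have := hu.inner_preimage_eq hy hg (bv_sub_mem_mov_iff.2 (Or.inl hx))
    simpa only [inner_sub_right, inner_bv] using this
  have hne := h g hg
  obtain ⟨h1, h2⟩ := paired_preimage hg ha hsc hac hsb
  obtain ⟨-, h3⟩ := paired_preimage hg ha hsc hac hsd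
  have tb := tr b hsb
  have td := tr d hsd
  have tc := tr c hsc
  refine ⟨by linarith, ?_⟩
  rcases h2 with h2 | h2 <;> rcases h3 with h3 | h3
  · exact absurd (h2.trans h3.symm) hne
  · left; constructor <;> linarith
  · right; constructor <;> linarith
  · exact absurd (h2.trans h3.symm) hne

/-- Take preimages `g` of `bv a` and `h` of `bv c`. Then `y` has the same values as `g - h` at `a`
and `c`, and polarisation gives `co g c = -co h a`, so the sum is `2 * co g c`, which is `±1`. -/
theorem preimage_add_ne_zero {w : GroupB n} {a c : SignedPoint n} (ha : Bal w a)
    (hac : a.1 ≠ c.1) (hs : w.1.SameCycle a c) {y : EuclideanSpace ℝ (Fin n)}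
    (hy : rep w y - y = bv a - bv c) : co y a + co y c ≠ 0 := by
  have hc := ha.of_sameCycle hs
  obtain ⟨g, hg, -⟩ := exists_bal_preimage ha
  obtain ⟨h, hh, -⟩ := exists_bal_preimage hc
  have hgh : rep w (g - h) - (g - h) = bv a - bv c := by
    rw [map_sub, ← hg, ← hh]; abel
  have e1 := (below_refl (rep w)).inner_preimage_eq hy hgh (bv_mem_mov_iff.2 ha)
  have e2 := (below_refl (rep w)).inner_preimage_eq hy hgh (bv_mem_mov_iff.2 hc)
  have e3 := inner_preimage_add hg hh
  have e4 := bal_preimage_self hg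
  have e5 := bal_preimage_self hh
  rw [inner_bv, inner_bv, co_sub] at e1 e2
  rw [inner_bv, inner_bv, inner_bv, co_bv_of_ne (Ne.symm hac)] at e3
  rcases bal_preimage_sq hg hs with h6 | h6 <;> intro h7 <;> linarith

end AtomJoins

/-! ### Existence of joins for the listed partitions. -/

section LatticeClass

variable {n : ℕ}

open Equiv.Perm

theorem IsBalReps.even_card {w : GroupB n} {R : Finset (SignedPoint n)} (h : IsBalReps w R)
    (hs : sign w.1 = 1) : Even R.card := by
  rw [sign_eq_neg_one_pow_card h] at hs
  by_contra hodd
  rw [Nat.not_even_iff_odd] at hodd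
  rw [hodd.neg_one_pow] at hs
  exact absurd hs (by decide)

theorem exists_bal_not_sameCycle {w : GroupB n} (hs : sign w.1 = 1) {x : SignedPoint n}
    (hx : Bal w x) : ∃ y, Bal w y ∧ ¬ w.1.SameCycle x y := by
  obtain ⟨R, hR⟩ := exists_isBalReps w
  obtain ⟨r, hr, hrx⟩ := hR.cover x hx
  have hne : R.card ≠ 1 := by
    intro h1
    have := hR.even_card hs
    rw [h1] at this
    exact absurd this (by decide)
  have hpos := Finset.card_pos.2 ⟨r, hr⟩
  obtain ⟨y, hy, hyr⟩ := Finset.exists_mem_ne (show 1 < R.card by omega) r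
  exact ⟨y, hR.bal y hy, fun h => hyr (hR.inj y hy r hr (hrx.trans h).symm)⟩

theorem eq_or_eq_opp_of_sameCycle {w : GroupB n} {x y : SignedPoint n} (hx : w.1 x = x.opp)
    (h : w.1.SameCycle x y) : y = x ∨ y = x.opp := by
  obtain ⟨k, rfl⟩ := h.exists_nat_pow_eq
  clear h
  induction k with
  | zero => left; rfl
  | succ k ih =>
    rw [pow_succ', mul_apply]
    rcases ih with h2 | h2
    · right; rw [h2, hx]
    · left; rw [h2, GroupB.map_opp, hx, opp_opp]

theorem apply_eq_opp_of_le {v w : GroupB n} (h : BLe v w) {x : SignedPoint n} (hx : Bal v x)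
    (hw : w.1 x = x.opp) : v.1 x = x.opp := by
  have h1 : v.1.SameCycle x (v.1 x) := ⟨1, by simp⟩
  have h2 := (bal_form_eq h hx (hx.of_sameCycle h1)).1 h1
  exact (eq_or_eq_opp_of_sameCycle hw h2).resolve_left hx.apply_ne

/-- All balanced points of `w` except `±o` lie in one cycle, and `w o = -o`. -/
structure IsHooked (w : GroupB n) (o : SignedPoint n) : Prop where
  apply : w.1 o = o.opp
  sameCycle : ∀ x y, Bal w x → Bal w y → x.1 ≠ o.1 → y.1 ≠ o.1 → w.1.SameCycle x y

open Classical in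
/-- The indices of the balanced points. -/
noncomputable def balIdx (w : GroupB n) : Finset (Fin n) := Finset.univ.filter fun i => Bal w (i, 1)

theorem mem_balIdx {w : GroupB n} {x : SignedPoint n} : x.1 ∈ balIdx w ↔ Bal w x := by
  simp [balIdx, bal_fst]

/-- All balanced cycles of `w` have length one, and there are at most four of them. -/
structure IsFourfold (w : GroupB n) : Prop where
  apply : ∀ x, Bal w x → w.1 x = x.opp
  card_le : (balIdx w).card ≤ 4

/-- The class of elements of `D_n` whose intervals are lattices. -/
structure IsLatticeType (w : GroupB n) : Prop where
  sign_eq : sign w.1 = 1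
  shape : (∀ x, ¬ Bal w x) ∨ (∃ o, IsHooked w o) ∨ IsFourfold w

theorem IsHooked.bal {w : GroupB n} {o : SignedPoint n} (h : IsHooked w o) : Bal w o :=
  ⟨1, by simpa using h.apply⟩

/-- An even `v` with one balanced cycle has a second. Away from `±o` all balanced points share a
cycle of `w`, hence of `v`, so one of the two cycles must contain `±o`. -/
theorem IsHooked.bal_of_le {v w : GroupB n} {o : SignedPoint n} (h : IsHooked w o) (hv : BLe v w)
    (hs : sign v.1 = 1) {x : SignedPoint n} (hx : Bal v x) : Bal v o := by
  obtain ⟨y, hy, hxy⟩ := exists_bal_not_sameCycle hs hx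
  by_contra ho
  have hne : ∀ z, Bal v z → z.1 ≠ o.1 := by
    intro z hz h1
    rw [← mem_balIdx, h1, mem_balIdx] at hz
    exact ho hz
  exact hxy ((bal_form_eq hv hx hy).2
    (h.sameCycle x y (hx.of_below hv) (hy.of_below hv) (hne x hx) (hne y hy)))

theorem IsFourfold.isBalReps {w : GroupB n} (h : IsFourfold w) :
    IsBalReps w ((balIdx w).map ⟨fun i => (i, 1), fun _ _ hij => congrArg Prod.fst hij⟩) := by
  refine ⟨fun x hx => ?_, fun x hx y hy hxy => ?_, fun x hx => ?_⟩
  · obtain ⟨i, hi, rfl⟩ := Finset.mem_map.1 hx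
    exact mem_balIdx.1 hi
  · obtain ⟨i, hi, rfl⟩ := Finset.mem_map.1 hx
    obtain ⟨j, hj, rfl⟩ := Finset.mem_map.1 hy
    have := eq_or_eq_opp_of_sameCycle (h.apply _ (mem_balIdx.1 hi)) hxy
    have h2 : j = i := by rcases this with h1 | h1 <;> exact congrArg Prod.fst h1
    rw [h2]
  · refine ⟨(x.1, 1), Finset.mem_map.2 ⟨x.1, mem_balIdx.2 hx, rfl⟩, ?_⟩
    rcases fst_eq_iff.1 (show x.1 = ((x.1, 1) : SignedPoint n).1 from rfl) with h1 | h1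
    · rw [← h1]
    · rw [← opp_eq_iff] at h1
      rw [← h1]
      exact SameCycle.symm hx

theorem IsFourfold.even_card {w : GroupB n} (h : IsFourfold w) (hs : sign w.1 = 1) :
    Even (balIdx w).card := by
  simpa using h.isBalReps.even_card hs

theorem IsFourfold.of_le {v w : GroupB n} (h : IsFourfold w) (hv : BLe v w) : IsFourfold v := by
  refine ⟨fun x hx => apply_eq_opp_of_le hv hx (h.apply x (hx.of_below hv)),
    (Finset.card_le_card fun i hi => ?_).trans h.card_le⟩
  exact mem_balIdx (x := (i, 1)).2 ((mem_balIdx (x := (i, 1)).1 hi).of_below hv)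

/-- Closure is what the induction over reflections needs; for this reason the fourfold shape only
bounds the number of balanced indices by four. An even element below a hooked one either has no
balanced points or is hooked at the same `o`. -/
theorem IsLatticeType.of_le {w v : GroupB n} (h : IsLatticeType w) (hs : sign v.1 = 1)
    (hv : BLe v w) : IsLatticeType v := by
  refine ⟨hs, ?_⟩
  rcases h.shape with h0 | ⟨o, ho⟩ | h2
  · exact Or.inl fun x hx => h0 x (hx.of_below hv)
  · by_cases hb : ∃ x, Bal v x
    · obtain ⟨x, hx⟩ := hb
      refine Or.inr (Or.inl ⟨o, apply_eq_opp_of_le hv (ho.bal_of_le hv hs hx) ho.apply, ?_⟩)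
      intro x y hx hy hxo hyo
      exact (bal_form_eq hv hx hy).2
        (ho.sameCycle x y (hx.of_below hv) (hy.of_below hv) hxo hyo)
    · push Not at hb
      exact Or.inl hb
  · exact Or.inr (Or.inr (h2.of_le hv))

/-- Crossing roots in a fourfold element have three different indices. -/
theorem IsFourfold.inner_ne_zero {w : GroupB n} (h : IsFourfold w) {a c b d : SignedPoint n}
    (hb : Bal w b) (hd : Bal w d) (hn : NonOrtho w a c b d) :
    co (bv b - bv d) a ≠ co (bv b - bv d) c := by
  intro heq
  -- On balanced coordinates `w` acts as `-1`, so there the form is `-1/2` times the inner product.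
  refine hn ((-(1 / 2) : ℝ) • (bv b - bv d)) ?_ (by rw [co_smul, co_smul, heq])
  rw [map_smul, map_sub, rep_bv, rep_bv, h.apply b hb, h.apply d hd, bv_opp, bv_opp]
  module

/-- Two roots supported on the same two indices are equal up to sign, and then define the same
reflection, or are orthogonal. -/
theorem exists_third_index {a c b d : SignedPoint n} (hac : a.1 ≠ c.1) (hbd : b.1 ≠ d.1)
    (hne : reflB a c ≠ reflB b d) (h : co (bv b - bv d) a ≠ co (bv b - bv d) c) :
    (b.1 ≠ a.1 ∧ b.1 ≠ c.1) ∨ (d.1 ≠ a.1 ∧ d.1 ≠ c.1) := by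
  by_contra! hcon
  have hb : b.1 = a.1 ∨ b.1 = c.1 := by
    by_contra! hb; exact hb.2 (hcon.1 hb.1)
  have hd : d.1 = a.1 ∨ d.1 = c.1 := by
    by_contra! hd; exact hd.2 (hcon.2 hd.1)
  have hca := hac.symm
  rcases hb with hb | hb <;> rcases hd with hd | hd
  · exact hbd (hb.trans hd.symm)
  · rcases fst_eq_iff.1 hb with rfl | rfl <;> rcases fst_eq_iff.1 hd with rfl | rfl
    · exact hne rfl
    · apply h
      simp [bv_opp, co_bv_self, co_bv_of_ne hac, co_bv_of_ne hca]
    · apply h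
      simp [bv_opp, co_bv_self, co_bv_of_ne hac, co_bv_of_ne hca]
    · exact hne (reflB_opp_opp _ _).symm
  · rcases fst_eq_iff.1 hb with rfl | rfl <;> rcases fst_eq_iff.1 hd with rfl | rfl
    · exact hne (reflB_comm _ _)
    · apply h
      simp [bv_opp, co_bv_self, co_bv_of_ne hac, co_bv_of_ne hca]
    · apply h
      simp [bv_opp, co_bv_self, co_bv_of_ne hac, co_bv_of_ne hca]
    · exact hne (by rw [reflB_opp_opp, reflB_comm])
  · exact hbd (hb.trans hd.symm)

/-- Crossing roots cannot be joined both in a paired cycle through `a`, `b` and in a paired cycle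
through `a`, `-b`. -/
theorem IsLatticeType.not_sameCycle_opp {w u v : GroupB n} (hw : IsLatticeType w)
    {a c b d : SignedPoint n} (hac : a.1 ≠ c.1) (hbd : b.1 ≠ d.1)
    (hn : NonOrtho w a c b d) (hn' : NonOrtho w b d a c) (hu : BLe u w) (hv : BLe v w)
    (hua : ¬ Bal u a) (hva : ¬ Bal v a) (hαu : u.1.SameCycle a c) (hβu : u.1.SameCycle b d)
    (hαv : v.1.SameCycle a c) (hβv : v.1.SameCycle b d) (hab : u.1.SameCycle a b) :
    ¬ v.1.SameCycle a b.opp := by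
  intro hab'
  have hane : a ≠ c := fun h => hac (h ▸ rfl)
  have hbne : b ≠ d := fun h => hbd (h ▸ rfl)
  have mu : ∀ {x y}, u.1.SameCycle x y → bv x - bv y ∈ mov (rep u) := fun h =>
    bv_sub_mem_mov_iff.2 (Or.inl h)
  have mv : ∀ {x y}, v.1.SameCycle x y → bv x - bv y ∈ mov (rep v) := fun h =>
    bv_sub_mem_mov_iff.2 (Or.inl h)
  have hub : ¬ Bal u b := fun h => hua (h.of_sameCycle hab.symm)
  have hvb : ¬ Bal v b := fun h => hva ((bal_opp.2 h).of_sameCycle hab'.symm)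
  -- `mov (rep w)` contains both `bv a - bv b` and `bv a + bv b`.
  have hwa : Bal w a := by
    have h1 := hu.mov_le (mu hab)
    have h2 := hv.mov_le (mv hab')
    rw [bv_opp] at h2
    rw [← bv_mem_mov_iff]
    have := Submodule.smul_mem _ (1 / 2 : ℝ) (add_mem h1 h2)
    convert this using 1
    module
  have hwc := (bal_iff_of_mem_mov (hu.mov_le (mu hαu))).1 hwa
  have hwb := (bal_iff_of_mem_mov (hu.mov_le (mu hab))).1 hwa
  have hwd := (bal_iff_of_mem_mov (hu.mov_le (mu hβu))).1 hwb
  -- A shared index would make `a` balanced in `u` or in `v`.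
  have hdisj : ∀ x y, u.1.SameCycle a x → u.1.SameCycle a y → v.1.SameCycle a x →
      v.1.SameCycle a y.opp → x.1 ≠ y.1 := by
    intro x y h1 h2 h3 h4 h5
    rcases fst_eq_iff.1 h5 with rfl | rfl
    · exact hva (Bal.of_sameCycle (x := x) (h3.symm.trans h4) h3.symm)
    · exact hua (Bal.of_sameCycle (x := y) (h2.symm.trans h1) h2.symm)
  have had := hab.trans hβu
  have had' := hab'.trans (sameCycle_opp hβv)
  have nu := hn.of_le hu (mu hαu) (mu hβu)
  have nu' := hn'.of_le hu (mu hβu) (mu hαu)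
  have nv := hn.of_le hv (mv hαv) (mv hβv)
  have nv' := hn'.of_le hv (mv hβv) (mv hαv)
  rcases hw.shape with h0 | ⟨o, ho⟩ | h2
  · exact h0 a hwa
  -- As the two roots have disjoint indices, at least one of them avoids `o`, and its two points
  -- then lie in one balanced cycle of `w`.
  · by_cases hao : a.1 ≠ o.1 ∧ c.1 ≠ o.1
    · have hs := ho.sameCycle a c hwa hwc hao.1 hao.2
      obtain ⟨y, hy⟩ := mem_mov.1 (bv_sub_mem_mov_iff.2 (Or.inl hs))
      have hne := preimage_add_ne_zero hwa hac hs hy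
      -- Through `u` the values of `y` at `b`, `d` are those at `a`, `c` in some order; through `v`
      -- they are the negatives of these. Hence `co y a + co y c = 0`, a contradiction.
      obtain ⟨e1, e2⟩ := NonOrtho.preimage_values hu nu' hane hua hαu hab had hy
      obtain ⟨-, e3⟩ := NonOrtho.preimage_values hv nv'.opp_left hane hva hαv hab' had' hy
      simp only [co_opp] at e3
      apply hne
      rcases e2 with ⟨e2, e4⟩ | ⟨e2, e4⟩ <;> rcases e3 with ⟨e3, e5⟩ | ⟨e3, e5⟩ <;> linarith
    · have hbo : b.1 ≠ o.1 ∧ d.1 ≠ o.1 := by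
        rw [not_and_or, not_not, not_not] at hao
        rcases hao with h | h <;> rw [← h]
        · exact ⟨(hdisj a b (SameCycle.refl _ _) hab (SameCycle.refl _ _) hab').symm,
            (hdisj a d (SameCycle.refl _ _) had (SameCycle.refl _ _) had').symm⟩
        · exact ⟨(hdisj c b hαu hab hαv hab').symm, (hdisj c d hαu had hαv had').symm⟩
      have hs := ho.sameCycle b d hwb hwd hbo.1 hbo.2
      obtain ⟨y, hy⟩ := mem_mov.1 (bv_sub_mem_mov_iff.2 (Or.inl hs))
      have hne := preimage_add_ne_zero hwb hbd hs hy
      have hba' : v.1.SameCycle b a.opp := sameCycle_opp_left.1 hab'.symm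
      obtain ⟨e1, e2⟩ := NonOrtho.preimage_values hu nu hbne hub hβu hab.symm
        (hab.symm.trans hαu) hy
      obtain ⟨-, e3⟩ := NonOrtho.preimage_values hv nv.opp_left hbne hvb hβv hba'
        (hba'.trans (sameCycle_opp hαv)) hy
      simp only [co_opp] at e3
      apply hne
      rcases e2 with ⟨e2, e4⟩ | ⟨e2, e4⟩ <;> rcases e3 with ⟨e3, e5⟩ | ⟨e3, e5⟩ <;> linarith
  · apply h2.inner_ne_zero hwb hwd hn
    rw [co_sub, co_sub, co_bv_of_ne, co_bv_of_ne, co_bv_of_ne, co_bv_of_ne]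
    · exact hdisj c d hαu had hαv had'
    · exact hdisj c b hαu hab hαv hab'
    · exact hdisj a d (SameCycle.refl _ _) had (SameCycle.refl _ _) had'
    · exact hdisj a b (SameCycle.refl _ _) hab (SameCycle.refl _ _) hab'

/-- Crossing roots with an upper bound containing them in one paired cycle have a join. -/
theorem IsLatticeType.hasJoin_of_paired {w u : GroupB n} (hw : IsLatticeType w)
    {a c b d : SignedPoint n} (hac : a.1 ≠ c.1) (hbd : b.1 ≠ d.1)
    (hn : NonOrtho w a c b d) (hn' : NonOrtho w b d a c) (hu : BLe u w)
    (hα : BLe (reflB a c) u) (hβ : BLe (reflB b d) u) (hua : ¬ Bal u a)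
    (hab : u.1.SameCycle a b) : HasJoin w (reflB a c) (reflB b d) := by
  classical
  have hs := isReflectionAlong_reflB (fun h' : a = c => hac (h' ▸ rfl))
  have ht := isReflectionAlong_reflB (fun h' : b = d => hbd (h' ▸ rfl))
  have hαu := sameCycle_of_mem_mov (hs.below_iff.1 hα) hua
  have hub : ¬ Bal u b := fun h => hua (h.of_sameCycle hab.symm)
  have hβu := sameCycle_of_mem_mov (ht.below_iff.1 hβ) hub
  set I : Finset (Fin n) := {a.1, c.1, b.1, d.1} with hI
  have hsame : ∀ x : SignedPoint n, x = a ∨ x = c ∨ x = b ∨ x = d → u.1.SameCycle a x := by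
    rintro x (rfl | rfl | rfl | rfl)
    · exact SameCycle.refl _ _
    · exact hαu
    · exact hab
    · exact hab.trans hβu
  have hnb : ∀ x : SignedPoint n, x.1 ∈ I → ¬ Bal u x := by
    intro x hx hbx
    have : ∃ y, (y = a ∨ y = c ∨ y = b ∨ y = d) ∧ x.1 = y.1 := by
      simp only [hI, Finset.mem_insert, Finset.mem_singleton] at hx
      rcases hx with h | h | h | h <;> exact ⟨_, by simp, h⟩
    obtain ⟨y, hy, hxy⟩ := this
    rw [← mem_balIdx, hxy, mem_balIdx] at hbx
    exact hua (hbx.of_sameCycle (hsame y hy).symm)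
  -- The candidate for the join; it is even because it has no balanced points.
  obtain ⟨z, hzu, hz⟩ := exists_restriction u I
  have hzs : sign z.1 = 1 := by
    have : IsBalReps z ∅ := by
      refine ⟨by simp, by simp, fun x hx => ?_⟩
      have h1 := ((hz _).1 (bv_mem_mov_iff.2 hx)).2 x.1
      have h2 : x.1 ∈ I := by
        by_contra h3
        have h4 := co_bv_self x
        rw [co, h1 h3, mul_zero] at h4
        exact zero_ne_one h4
      exact absurd (hx.of_below hzu) (hnb x h2)
    simpa using sign_eq_neg_one_pow_card this
  have hsupp : ∀ x y : SignedPoint n, x.1 ∈ I → y.1 ∈ I → ∀ i ∉ I, (bv x - bv y) i = 0 := by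
    intro x y hx hy i hi
    have hco : ∀ v : EuclideanSpace ℝ (Fin n), v i = co v (i, 1) := fun v => by simp [co]
    rw [hco, co_sub, co_bv_of_ne, co_bv_of_ne, sub_self]
    · rintro rfl; exact hi hy
    · rintro rfl; exact hi hx
  refine ⟨z, hzs, Below.trans hzu hu, ?_, ?_, fun v hv hvw hαv hβv => ?_⟩
  · exact hs.below_iff.2 ((hz _).2 ⟨hs.below_iff.1 hα, hsupp a c (by simp [hI]) (by simp [hI])⟩)
  · exact ht.below_iff.2 ((hz _).2 ⟨ht.below_iff.1 hβ, hsupp b d (by simp [hI]) (by simp [hI])⟩)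
  · refine below_of_mov_le (Below.trans hzu hu) hvw fun ξ hξ => ?_
    have mα := hs.below_iff.1 hαv
    have mβ := ht.below_iff.1 hβv
    -- The two roots alone do not link `a` to `b`. If `a` is balanced in `v`, crossing makes `b`
    -- balanced too; otherwise crossing puts `a` in the cycle of `b` or of `-b`, and the latter is
    -- excluded.
    have mab : bv a - bv b ∈ mov (rep v) := by
      rw [bv_sub_mem_mov_iff]
      by_cases hva : Bal v a
      · right
        refine ⟨hva, ?_⟩
        by_contra hvb
        have := (hn.of_le hvw mα mβ).sameCycle mα mβ hvb
        rcases this with h | h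
        · exact hvb (hva.of_sameCycle h)
        · exact hvb (bal_opp.1 (hva.of_sameCycle h))
      · left
        have hαv' := sameCycle_of_mem_mov mα hva
        have h1 := (hn'.of_le hvw mβ mα).sameCycle mβ mα hva
        have hvb : ¬ Bal v b := by
          intro hvb
          rcases h1 with h | h
          · exact hva (hvb.of_sameCycle h)
          · exact hva (bal_opp.1 (hvb.of_sameCycle h))
        have hβv' := sameCycle_of_mem_mov mβ hvb
        rcases h1 with h | h
        · exact h.symm
        · exact absurd (sameCycle_opp_left.1 h.symm) (hw.not_sameCycle_opp hac hbd hn hn' hu hvw hua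
            hva hαu hβu hαv' hβv' hab)
    obtain ⟨hξu, hξI⟩ := (hz ξ).1 hξ
    set S : Submodule ℝ (EuclideanSpace ℝ (Fin n)) := mov (rep v) ⊓ mov (rep u) with hS
    have hSx : ∀ x, x = a ∨ x = c ∨ x = b ∨ x = d → bv a - bv x ∈ S := by
      intro x hx
      refine ⟨?_, bv_sub_mem_mov_iff.2 (Or.inl (hsame x hx))⟩
      rcases hx with rfl | rfl | rfl | rfl
      · rw [sub_self]; exact zero_mem _
      · exact mα
      · exact mab
      · have := add_mem mab mβ
        rwa [sub_add_sub_cancel] at this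
    -- All coordinate vectors involved are congruent to `±bv a` modulo `S`. Pairing with the fixed
    -- vector `orbitVec u a` then kills the remaining multiple of `bv a`.
    have hξS : ξ ∈ S ⊔ Submodule.span ℝ {bv a} := by
      refine mem_of_bv_mem (I := I) (fun i hi => ?_) hξI
      have key : ∀ x, x = a ∨ x = c ∨ x = b ∨ x = d →
          bv (x.1, 1) ∈ S ⊔ Submodule.span ℝ {bv a} := by
        intro x hx
        have h1 : bv x ∈ S ⊔ Submodule.span ℝ {bv a} := by
          have := sub_mem (Submodule.mem_sup_right (Submodule.mem_span_singleton_self (bv a)))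
            (Submodule.mem_sup_left (T := Submodule.span ℝ {bv a}) (hSx x hx))
          rwa [sub_sub_cancel] at this
        rcases fst_eq_iff.1 (show x.1 = ((x.1, 1) : SignedPoint n).1 from rfl) with h | h
        · rwa [← h]
        · rw [← opp_eq_iff] at h
          rw [← h, bv_opp]
          exact neg_mem h1
      simp only [hI, Finset.mem_insert, Finset.mem_singleton] at hi
      rcases hi with rfl | rfl | rfl | rfl <;> exact key _ (by simp)
    obtain ⟨s, hs, t, ht, rfl⟩ := Submodule.mem_sup.1 hξS
    obtain ⟨k, rfl⟩ := Submodule.mem_span_singleton.1 ht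
    have h1 := inner_mov_fixSpace hξu (rep_orbitVec u a)
    rw [inner_add_left, inner_mov_fixSpace hs.2 (rep_orbitVec u a), inner_smul_left,
      real_inner_comm, inner_bv, co_orbitVec, if_pos (SameCycle.refl _ _),
      if_neg fun h => hua h.symm] at h1
    have hk : k = 0 := by simpa using h1
    rw [hk, zero_smul, add_zero]
    exact hs.1

/-- Crossing roots all of whose upper bounds contain them in balanced cycles have a join. -/
theorem IsLatticeType.hasJoin_of_balanced {w : GroupB n} (hw : IsLatticeType w)
    {a c b d : SignedPoint n} (hac : a.1 ≠ c.1) (hbd : b.1 ≠ d.1) (hne : reflB a c ≠ reflB b d)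
    (hn : NonOrtho w a c b d) (hα : BLe (reflB a c) w) (hβ : BLe (reflB b d) w)
    (hbal : ∀ u : GroupB n, sign u.1 = 1 → BLe u w → BLe (reflB a c) u → BLe (reflB b d) u →
      Bal u a ∧ Bal u c ∧ Bal u b ∧ Bal u d) : HasJoin w (reflB a c) (reflB b d) := by
  classical
  have hane : a ≠ c := fun h => hac (h ▸ rfl)
  have hbne : b ≠ d := fun h => hbd (h ▸ rfl)
  obtain ⟨hwa, hwc, hwb, hwd⟩ := hbal w hw.sign_eq (below_refl _) hα hβ
  rcases hw.shape with h0 | ⟨o, ho⟩ | h2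
  · exact absurd hwa (h0 a)
  · have hmemI : ∀ x : SignedPoint n, x.1 ∈ ({a.1, c.1, b.1, d.1, o.1} : Finset (Fin n)) →
        ∃ y, (y = a ∨ y = c ∨ y = b ∨ y = d ∨ y = o) ∧ x.1 = y.1 := by
      intro x hx
      simp only [Finset.mem_insert, Finset.mem_singleton] at hx
      rcases hx with h | h | h | h | h <;> exact ⟨_, by simp, h⟩
    have hI : ∀ v : GroupB n, Bal v a → Bal v c → Bal v b → Bal v d → Bal v o →
        ∀ x : SignedPoint n, x.1 ∈ ({a.1, c.1, b.1, d.1, o.1} : Finset (Fin n)) → Bal v x := by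
      intro v ha hc hb hd ho x hx
      obtain ⟨y, hy, hxy⟩ := hmemI x hx
      rw [← mem_balIdx, hxy, mem_balIdx]
      rcases hy with rfl | rfl | rfl | rfl | rfl <;> assumption
    -- Every even upper bound has `o` as a balanced point, so `o` joins the four indices. The
    -- restriction has two balanced cycles, that of `o` and that of `r`, and is therefore even.
    obtain ⟨z, hz⟩ := exists_isBalRestriction (fun i hi => hI w hwa hwc hwb hwd ho.bal (i, 1) hi)
    have hr : ∃ r, (r = a ∨ r = c) ∧ r.1 ≠ o.1 := by
      by_cases h : a.1 = o.1
      · exact ⟨c, Or.inr rfl, fun h' => hac (h.trans h'.symm)⟩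
      · exact ⟨a, Or.inl rfl, h⟩
    obtain ⟨r, hrac, hro⟩ := hr
    have hwr : Bal w r := by rcases hrac with rfl | rfl <;> assumption
    have hnr : ¬ w.1.SameCycle o r := fun h => by
      rcases eq_or_eq_opp_of_sameCycle ho.apply h with rfl | rfl <;> exact hro rfl
    have hzs : sign z.1 = 1 := by
      have hro' : r ≠ o := fun h => hro (h ▸ rfl)
      rw [hz.sign_eq (R := {r, o}), Finset.card_pair hro']
      · rfl
      · intro x hx
        simp only [Finset.mem_insert, Finset.mem_singleton] at hx ⊢
        rcases hx with rfl | rfl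
        · rcases hrac with rfl | rfl <;> simp
        · simp
      · intro x hx y hy hxy
        simp only [Finset.mem_insert, Finset.mem_singleton] at hx hy
        rcases hx with rfl | rfl <;> rcases hy with rfl | rfl
        · rfl
        · exact absurd hxy.symm hnr
        · exact absurd hxy hnr
        · rfl
      · intro x hx
        by_cases hxo : x.1 = o.1
        · exact exists_fst_sameCycle (by simp [hwr, ho.bal]) ⟨o, by simp, hxo⟩
        · exact ⟨r, by simp, ho.sameCycle r x hwr (hI w hwa hwc hwb hwd ho.bal x hx) hro hxo⟩
    refine ⟨z, hzs, hz.le, hz.refl_le hane (by simp) (by simp), hz.refl_le hbne (by simp) (by simp),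
      fun u hu huw hαu hβu => hz.le_of_bal huw fun i hi => ?_⟩
    obtain ⟨ha, hc, hb, hd⟩ := hbal u hu huw hαu hβu
    exact hI u ha hc hb hd (ho.bal_of_le huw hu ha) (i, 1) hi
  · obtain ⟨z, hz⟩ := exists_isBalRestriction (w := w) (I := balIdx w)
      (fun i hi => mem_balIdx (x := (i, 1)).1 hi)
    have hzs : sign z.1 = 1 := by
      rw [← hw.sign_eq, sign_eq_neg_one_pow_card h2.isBalReps]
      refine hz.sign_eq (fun x hx => mem_balIdx.2 (h2.isBalReps.bal x hx)) h2.isBalReps.inj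
        fun x hx => h2.isBalReps.cover x (mem_balIdx.1 hx)
    refine ⟨z, hzs, hz.le, hz.refl_le hane (mem_balIdx.2 hwa) (mem_balIdx.2 hwc),
      hz.refl_le hbne (mem_balIdx.2 hwb) (mem_balIdx.2 hwd),
      fun u hu huw hαu hβu => hz.le_of_bal huw fun i hi => ?_⟩
    obtain ⟨ha, hc, hb, hd⟩ := hbal u hu huw hαu hβu
    -- Crossing roots yield at least three balanced indices in `u`. Their number is even and at most
    -- four, so `u` has all balanced indices of `w`.
    have hthird : ∃ x, Bal u x ∧ x.1 ≠ a.1 ∧ x.1 ≠ c.1 := by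
      rcases exists_third_index hac hbd hne (h2.inner_ne_zero hwb hwd hn) with h | h
      · exact ⟨b, hb, h⟩
      · exact ⟨d, hd, h⟩
    obtain ⟨x, hx, hxa, hxc⟩ := hthird
    have h3 : 3 ≤ (balIdx u).card := by
      have : ({a.1, c.1, x.1} : Finset (Fin n)) ⊆ balIdx u := by
        intro j hj
        simp only [Finset.mem_insert, Finset.mem_singleton] at hj
        rcases hj with rfl | rfl | rfl <;> exact mem_balIdx.2 (by assumption)
      have h4 := Finset.card_le_card this
      rwa [Finset.card_eq_three.2 ⟨_, _, _, hac, hxa.symm, hxc.symm, rfl⟩] at h4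
    have heven := (h2.of_le huw).even_card hu
    have hsub : balIdx u ⊆ balIdx w := fun j hj =>
      mem_balIdx (x := (j, 1)).2 ((mem_balIdx (x := (j, 1)).1 hj).of_below huw)
    have heq : balIdx u = balIdx w := by
      refine Finset.eq_of_subset_of_card_le hsub (h2.card_le.trans ?_)
      obtain ⟨m, hm⟩ := heven
      omega
    rw [← heq] at hi
    exact mem_balIdx (x := (i, 1)).1 hi

theorem IsLatticeType.hasJoin_reflB {w : GroupB n} (hw : IsLatticeType w)
    {a b c d : SignedPoint n} (hac : a.1 ≠ c.1) (hbd : b.1 ≠ d.1) (hα : BLe (reflB a c) w)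
    (hβ : BLe (reflB b d) w) : HasJoin w (reflB a c) (reflB b d) := by
  by_cases hne : reflB a c = reflB b d
  · rw [hne]
    exact hasJoin_of_le (sign_reflB hbd) hβ (below_refl _)
  by_cases hn : NonOrtho w a c b d
  swap
  · exact hasJoin_of_not_nonOrtho hac hbd hα hn
  by_cases hn' : NonOrtho w b d a c
  swap
  · exact (hasJoin_of_not_nonOrtho hbd hac hβ hn').symm
  have hs := isReflectionAlong_reflB (fun h' : a = c => hac (h' ▸ rfl))
  have ht := isReflectionAlong_reflB (fun h' : b = d => hbd (h' ▸ rfl))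
  by_cases hex : ∃ u : GroupB n, BLe u w ∧ BLe (reflB a c) u ∧ BLe (reflB b d) u ∧ ¬ Bal u a
  · obtain ⟨u, hu, hαu, hβu, hua⟩ := hex
    have mα := hs.below_iff.1 hαu
    have mβ := ht.below_iff.1 hβu
    rcases (hn'.of_le hu mβ mα).sameCycle mβ mα hua with h | h
    · exact hw.hasJoin_of_paired hac hbd hn hn' hu hαu hβu hua h.symm
    -- Replacing `b`, `d` by their negatives leaves the reflection unchanged and moves `b` into the
    -- cycle of `a`.
    · rw [← reflB_opp_opp b d] at hβu ⊢
      exact hw.hasJoin_of_paired hac (by exact hbd) hn.opp hn'.opp_left hu hαu hβu hua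
        (sameCycle_opp_left.1 h.symm)
  · push Not at hex
    refine hw.hasJoin_of_balanced hac hbd hne hn hα hβ fun u _ hu hαu hβu => ?_
    have mα := hs.below_iff.1 hαu
    have mβ := ht.below_iff.1 hβu
    have hua := hex u hu hαu hβu
    have hub : Bal u b := by
      by_contra hub
      rcases (hn.of_le hu mα mβ).sameCycle mα mβ hub with h | h
      · exact hub (hua.of_sameCycle h)
      · exact hub (bal_opp.1 (hua.of_sameCycle h))
    exact ⟨hua, (bal_iff_of_mem_mov mα).1 hua, hub, (bal_iff_of_mem_mov mβ).1 hub⟩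

theorem IsLatticeType.hasJoin {w : GroupB n} (hw : IsLatticeType w) {x y : GroupB n}
    (hx : sign x.1 = 1) (hy : sign y.1 = 1) (hxw : BLe x w) (hyw : BLe y w) : HasJoin w x y :=
  hasJoin_of_atoms (P := IsLatticeType) (fun _ _ h hs hv => h.of_le hs hv) (fun _ h => h.sign_eq)
    (fun _ h _ _ _ _ hac hbd hα hβ => h.hasJoin_reflB hac hbd hα hβ) hw hx hy hxw hyw

end LatticeClass

/-! ### The partitions for which all joins exist. -/

section Characterisation

variable {n : ℕ}

open Equiv.Perm

theorem isLatticeType_of_partition {w : GroupB n} (hs : sign w.1 = 1)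
    (h : balancedPartition w = 0 ∨ (∃ k : ℕ, 1 ≤ k ∧ k + 1 ≤ n ∧ balancedPartition w = {k, 1}) ∨
      balancedPartition w = {1, 1, 1, 1}) : IsLatticeType w := by
  refine ⟨hs, ?_⟩
  obtain ⟨R, hR⟩ := exists_isBalReps w
  rw [balancedPartition_eq hR] at h
  rcases h with h | ⟨k, -, -, h⟩ | h
  · left
    intro x hx
    obtain ⟨r, hr, -⟩ := hR.cover x hx
    rw [Multiset.map_eq_zero] at h
    rw [← Finset.mem_val, h] at hr
    exact absurd hr (Multiset.notMem_zero r)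
  · right; left
    have h1 : (1 : ℕ) ∈ R.val.map fun x => rk (rep (balCycle w x)) := by rw [h]; simp
    obtain ⟨o, ho, ho1⟩ := Multiset.mem_map.1 h1
    have hcard : R.card = 2 := by
      have := congrArg Multiset.card h
      simpa using this
    have ho' := (rk_balCycle_eq_one_iff (hR.bal o ho)).1 ho1
    refine ⟨o, ho', fun x y hx hy hxo hyo => ?_⟩
    obtain ⟨r, hr, hrx⟩ := hR.cover x hx
    obtain ⟨s, hs, hsy⟩ := hR.cover y hy
    have key : ∀ x r, w.1.SameCycle r x → x.1 ≠ o.1 → r ≠ o := by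
      rintro x r hrx hxo rfl
      rcases eq_or_eq_opp_of_sameCycle ho' hrx with rfl | rfl <;> exact hxo rfl
    have hrs : r = s := by
      have h2 : (R.erase o).card = 1 := by rw [Finset.card_erase_of_mem ho, hcard]
      exact Finset.card_le_one.1 h2.le r (Finset.mem_erase.2 ⟨key x r hrx hxo, hr⟩) s
        (Finset.mem_erase.2 ⟨key y s hsy hyo, hs⟩)
    exact hrx.symm.trans (hrs ▸ hsy)
  · right; right
    have hcard : R.card = 4 := by
      have := congrArg Multiset.card h
      simpa using this
    have hone : ∀ r ∈ R, w.1 r = r.opp := by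
      intro r hr
      rw [← rk_balCycle_eq_one_iff (hR.bal r hr)]
      have : rk (rep (balCycle w r)) ∈ R.val.map fun x => rk (rep (balCycle w x)) :=
        Multiset.mem_map_of_mem _ hr
      rw [h] at this
      simpa using this
    have horb : ∀ x, Bal w x → ∃ r ∈ R, x = r ∨ x = r.opp := by
      intro x hx
      obtain ⟨r, hr, hrx⟩ := hR.cover x hx
      exact ⟨r, hr, eq_or_eq_opp_of_sameCycle (hone r hr) hrx⟩
    refine ⟨fun x hx => ?_, ?_⟩
    · obtain ⟨r, hr, rfl | rfl⟩ := horb x hx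
      · exact hone x hr
      · rw [GroupB.map_opp, hone r hr]
    · rw [← hcard]
      refine (Finset.card_le_card (t := R.image Prod.fst) fun i hi => ?_).trans Finset.card_image_le
      obtain ⟨r, hr, h1⟩ := horb (i, 1) (mem_balIdx (x := (i, 1)).1 hi)
      refine Finset.mem_image.2 ⟨r, hr, ?_⟩
      rcases h1 with h1 | h1 <;> exact (congrArg Prod.fst h1).symm

/-- If some balanced cycle has length at least two, the first obstruction leaves a single balanced
index outside it, and evenness requires one: the partition is `(k, 1)`. Otherwise all parts are `1`,
and the second obstruction with evenness leaves zero, two or four of them. -/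
theorem partition_of_hasJoin {w : GroupB n} (hs : sign w.1 = 1)
    (h : ∀ x y : GroupB n, sign x.1 = 1 → sign y.1 = 1 → BLe x w → BLe y w → HasJoin w x y) :
    balancedPartition w = 0 ∨ (∃ k : ℕ, 1 ≤ k ∧ k + 1 ≤ n ∧ balancedPartition w = {k, 1}) ∨
      balancedPartition w = {1, 1, 1, 1} := by
  classical
  obtain ⟨R, hR⟩ := exists_isBalReps w
  have heven := hR.even_card hs
  have hpair : ∀ r s, R = {r, s} → r ≠ s → w.1 s = s.opp →
      ∃ k : ℕ, 1 ≤ k ∧ k + 1 ≤ n ∧ balancedPartition w = {k, 1} := by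
    intro r s hrs hne hs1
    have hr : r ∈ R := by rw [hrs]; simp
    have hs : s ∈ R := by rw [hrs]; simp
    refine ⟨rk (rep (balCycle w r)), one_le_rk_balCycle (hR.bal r hr),
      -- The bound `k + 1 ≤ n` holds because the cycle of `r` fixes the point `s`.
      rk_balCycle_lt (hR.bal r hr) (y := s) fun h => hne (hR.inj r hr s hs h), ?_⟩
    rw [balancedPartition_eq hR, ← (rk_balCycle_eq_one_iff (hR.bal s hs)).2 hs1, hrs,
      Finset.insert_val_of_notMem (by simpa using hne)]
    simp
  by_cases hlong : ∃ a ∈ R, w.1 a ≠ a.opp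
  · right; left
    obtain ⟨a, ha, hal⟩ := hlong
    obtain ⟨s, hs', has⟩ := exists_bal_not_sameCycle hs (hR.bal a ha)
    have huniq : ∀ c d, Bal w c → Bal w d → ¬ w.1.SameCycle a c → ¬ w.1.SameCycle a d →
        c.1 = d.1 := by
      intro c d hc hd hac had
      by_contra hcd
      obtain ⟨x, y, hx, hy, hxw, hyw, hn⟩ :=
        exists_not_hasJoin_of_long (hR.bal a ha) hal hc hd hac had hcd
      exact hn (h x y hx hy hxw hyw)
    obtain ⟨r, hr, hrs⟩ := hR.cover s hs'
    have har : ¬ w.1.SameCycle a r := fun h => has (h.trans hrs)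
    refine hpair a r ?_ (fun h => har (h ▸ SameCycle.refl _ _)) ?_
    · ext t
      simp only [Finset.mem_insert, Finset.mem_singleton]
      constructor
      · intro ht
        by_cases hat : w.1.SameCycle a t
        · exact Or.inl (hR.inj a ha t ht hat).symm
        · right
          refine hR.inj t ht r hr ?_
          rcases fst_eq_iff.1 (huniq t r (hR.bal t ht) (hR.bal r hr) hat har) with rfl | rfl
          · exact SameCycle.refl _ _
          · exact SameCycle.symm (hR.bal r hr)
      · rintro (rfl | rfl) <;> assumption
    · have h1 : w.1.SameCycle r (w.1 r) := ⟨1, by simp⟩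
      have h2 := huniq (w.1 r) r ((hR.bal r hr).of_sameCycle h1) (hR.bal r hr)
        (fun h => har (h.trans h1.symm)) har
      exact (fst_eq_iff.1 h2).resolve_left (hR.bal r hr).apply_ne
  · push Not at hlong
    have hle : R.card ≤ 4 := by
      by_contra hgt
      obtain ⟨x, y, hx, hy, hxw, hyw, hn⟩ :=
        exists_not_hasJoin_of_five hR.bal hR.inj (show 5 ≤ R.card by omega)
      exact hn (h x y hx hy hxw hyw)
    have hrep : balancedPartition w = Multiset.replicate R.card 1 := by
      rw [balancedPartition_eq hR, Multiset.map_congr rfl fun x hx =>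
        (rk_balCycle_eq_one_iff (hR.bal x hx)).2 (hlong x hx), Multiset.map_const']
      rfl
    obtain ⟨m, hm⟩ := heven
    have hm' : m = 0 ∨ m = 1 ∨ m = 2 := by omega
    rcases hm' with rfl | rfl | rfl
    · left; rw [hrep, hm]; rfl
    · right; left
      obtain ⟨r, s, hrs, hR2⟩ := Finset.card_eq_two.1 hm
      exact hpair r s hR2 hrs (hlong s (by rw [hR2]; simp))
    · right; right; rw [hrep, hm]; rfl

end Characterisation

theorem theorem5p2 (n : ℕ) (w : GroupD n) :
    AbsIntervalIsLattice (reflectionsD n) 1 w ↔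
      balancedPartition (w : GroupB n) = 0 ∨
      (∃ k : ℕ, 1 ≤ k ∧ k + 1 ≤ n ∧ balancedPartition (w : GroupB n) = {k, 1}) ∨
      balancedPartition (w : GroupB n) = {1, 1, 1, 1} := by
  have hs := sign_of_mem_groupD w.2
  rw [absIntervalIsLattice_iff]
  refine ⟨partition_of_hasJoin hs, fun h x y hx hy hxw hyw => ?_⟩
  exact (isLatticeType_of_partition hs h).hasJoin hx hy hxw hyw
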